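/- Let $X$ be a complex manifold of dimension $n\ge 1$ (Hausdorff, second countable, not necessarily compact) with a Kähler form $\omega$, let $c\in\mathbb{R}$, and let $\rho:\mathbb{C}^n\to[0,\infty)$ be a mollifier, i.e. a smooth function with $\rho(w)=0$ for $|w|>1$ and $\int\rho=1$. For a positive definite Hermitian $n\times n$ matrix $B$ and a Hermitian matrix $A$ let $$P_B(A)=\max_{k=1,\dots,n}\sum_{j\ne k}\frac1{\lambda_j}\in[0,\infty],$$ where $\lambda_1,\dots,\lambda_n$ are the eigenvalues of $B^{-1}A$ and $1/\lambda:=+\infty$ if $\lambda\le 0$. For $(1,1)$-forms, $P$ is applied to the coefficient matrices in holomorphic coordinates. Let $\chi$ be a closed positive $(1,1)$-current on $X$. A local potential of $\chi$ on an open subset $U$ of a coordinate neighborhood is an (upper semicontinuous, locally integrable) plurisubharmonic function $\varphi:U\to[-\infty,\infty)$ with $\sqrt{-1}\partial\bar\partial\varphi=\chi$ on $U$ in the sense of currents. (1) We write $P_\omega(\chi)\le_v c$ if for every point $x\in X$, every coordinate neighborhood $U$ of $x$, every local potential $\varphi$ of $\chi$ on $U$, and every upper test $q$ of $\varphi$ at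 $x$ (a real-valued $C^2$ function $q$ on a neighborhood of $x$ with $q\ge\varphi$ and $q(x)=\varphi(x)$), one has $P_{\omega}(\sqrt{-1}\partial\bar\partial q)(x)\le c$. (2) We write $\chi\in\bar\Gamma_{\omega,c}$ if for every open subset $O$ of every coordinate neighborhood, every Kähler form $\omega_0$ on $O$ with constant coefficients such that $\omega_0\le\omega$, every local potential $\varphi$ of $\chi$ on $O$, and every $\delta>0$, one has $$P_{\omega_0}(\sqrt{-1}\partial\bar\partial\varphi_\delta)\le c\quad\text{on } O_\delta=\{z\in O\mid d(z,\partial O)>\delta\},\qquad \varphi_\delta(z)=\int_{\mathbb{C}^n}\varphi(z-\delta w)\,\rho(w)\,dw .$$ Then $P_\omega(\chi)\le_v c$ if and only if $\chi\in\bar\Gamma_{\omega,c}$. -/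

import Mathlib

open MeasureTheory TopologicalSpace
open scoped Manifold Distributions LineDeriv ComplexConjugate ComplexOrder

noncomputable section

/-- The model space `ℂⁿ` with its Euclidean norm and Lebesgue measure. -/
abbrev Cn (n : ℕ) : Type := EuclideanSpace ℂ (Fin n)

/-- The `j`-th standard basis vector of `ℂⁿ`. -/
def stdVec (n : ℕ) (j : Fin n) : Cn n := EuclideanSpace.single j (1 : ℂ)

/-! ### Complex derivatives on `ℂⁿ` -/

/-- `∂f/∂z_j = (1/2) (∂f/∂x_j - i ∂f/∂y_j)`. -/
def wirtinger {n : ℕ} (j : Fin n) (f : Cn n → ℂ) (z : Cn n) : ℂ :=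
  (1 / 2 : ℂ) * (fderiv ℝ f z (stdVec n j) - Complex.I * fderiv ℝ f z (Complex.I • stdVec n j))

/-- `∂f/∂z̄_j = (1/2) (∂f/∂x_j + i ∂f/∂y_j)`. -/
def wirtingerBar {n : ℕ} (j : Fin n) (f : Cn n → ℂ) (z : Cn n) : ℂ :=
  (1 / 2 : ℂ) * (fderiv ℝ f z (stdVec n j) + Complex.I * fderiv ℝ f z (Complex.I • stdVec n j))

/-- The complex Hessian `(∂²f/∂z_j∂z̄_k)` of a real function: the coefficient matrix of the form
`√-1 ∂∂̄ f = √-1 ∑ f_{jk̄} dz_j ∧ dz̄_k`. -/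
def complexHessian {n : ℕ} (f : Cn n → ℝ) (z : Cn n) : Matrix (Fin n) (Fin n) ℂ :=
  Matrix.of fun j k => wirtinger j (wirtingerBar k (fun y => (f y : ℂ))) z

/-- `∂T/∂z_j` for a distribution `T`. -/
def wirtingerDist {n : ℕ} {Ω : Opens (Cn n)} (j : Fin n) (T : 𝓓'(Ω, ℂ)) (η : 𝓓(Ω, ℝ)) : ℂ :=
  (1 / 2 : ℂ) * ((∂_{stdVec n j} T) η - Complex.I * (∂_{Complex.I • stdVec n j} T) η)

/-- `∂T/∂z̄_j` for a distribution `T`. -/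
def wirtingerBarDist {n : ℕ} {Ω : Opens (Cn n)} (j : Fin n) (T : 𝓓'(Ω, ℂ)) (η : 𝓓(Ω, ℝ)) : ℂ :=
  (1 / 2 : ℂ) * ((∂_{stdVec n j} T) η + Complex.I * (∂_{Complex.I • stdVec n j} T) η)

/-! ### The operator `P` -/

/-- The eigenvalues of `B⁻¹ A`, with multiplicity (they are real when `B` is positive definite and
`A` is Hermitian). -/
def relEigenvalues {n : ℕ} (B A : Matrix (Fin n) (Fin n) ℂ) : Multiset ℝ :=
  (B⁻¹ * A).charpoly.roots.map Complex.re

/-- `P_B(A) = max_k ∑_{j ≠ k} 1/λ_j`, where the `λ_j` are the eigenvalues of `B⁻¹ A`. It is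
`[0, ∞]`-valued, with `1/λ = ∞` for `λ ≤ 0`; on positive definite `A` it is the usual number. -/
def opP {n : ℕ} (B A : Matrix (Fin n) (Fin n) ℂ) : ENNReal :=
  ((relEigenvalues B A).map fun l =>
    (((relEigenvalues B A).erase l).map fun m => (ENNReal.ofReal m)⁻¹).sum).sup

/-! ### Complex manifolds, Kähler forms and currents, in holomorphic charts -/

section Manifold

variable (n : ℕ) (X : Type*) [TopologicalSpace X] [ChartedSpace (Cn n) X]

/-- The holomorphic charts of `X` (all charts of the maximal holomorphic atlas). -/
abbrev HolChart : Type _ := ↥(IsManifold.maximalAtlas 𝓘(ℂ, Cn n) (⊤ : WithTop ℕ∞) X)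

variable {n X}

/-- The image of a chart in `ℂⁿ`, as an open set. -/
def HolChart.image (e : HolChart n X) : Opens (Cn n) := ⟨e.1.target, e.1.open_target⟩

/-- The points of the image of `e` that lie over the domain of `e'`. -/
def HolChart.overlap (e e' : HolChart n X) : Set (Cn n) :=
  {z | z ∈ e.1.target ∧ e.1.symm z ∈ e'.1.source}

/-- The coordinate change `τ = e' ∘ e⁻¹`, meaningful on `e.overlap e'`. -/
def HolChart.transition (e e' : HolChart n X) (z : Cn n) : Cn n := e'.1 (e.1.symm z)

/-- The complex Jacobian matrix `(∂τ_a/∂z_j)_{a j}` of the coordinate change. -/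
def HolChart.jacobian (e e' : HolChart n X) (z : Cn n) : Matrix (Fin n) (Fin n) ℂ :=
  Matrix.of fun a j => (fderiv ℂ (e.transition e') z (stdVec n j)) a

variable (n X)

/-- A Kähler form on `X`: a smooth closed positive definite real `(1,1)`-form, given in each
holomorphic chart by its coefficients, `ω = √-1 ∑ g_{jk̄} dz_j ∧ dz̄_k`. -/
structure KahlerForm where
  /-- the coefficient matrix `(g_{jk̄}(z))` in the chart `e`, for `z` in the image of `e` -/
  coeff : HolChart n X → Cn n → Matrix (Fin n) (Fin n) ℂ
  /-- the coefficients of one and the same form: transformation under coordinate changes -/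
  compat : ∀ e e' : HolChart n X, ∀ z ∈ e.overlap e', ∀ j k : Fin n,
    coeff e z j k = ∑ a, ∑ b, coeff e' (e.transition e' z) a b *
      e.jacobian e' z a j * conj (e.jacobian e' z b k)
  smooth : ∀ e : HolChart n X, ∀ j k : Fin n,
    ContDiffOn ℝ ((⊤ : ℕ∞) : WithTop ℕ∞) (fun z => coeff e z j k) e.1.target
  posDef : ∀ e : HolChart n X, ∀ z ∈ e.1.target, (coeff e z).PosDef
  closed : ∀ e : HolChart n X, ∀ z ∈ e.1.target, ∀ j k l : Fin n,
    wirtinger l (fun y => coeff e y j k) z = wirtinger j (fun y => coeff e y l k) z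
  closedBar : ∀ e : HolChart n X, ∀ z ∈ e.1.target, ∀ j k l : Fin n,
    wirtingerBar l (fun y => coeff e y j k) z = wirtingerBar k (fun y => coeff e y j l) z

/-- A closed positive `(1,1)`-current on `X`: in each holomorphic chart a form
`χ = √-1 ∑ T_{jk̄} dz_j ∧ dz̄_k` with distribution coefficients, which is positive and closed. -/
structure ClosedPositiveCurrent where
  /-- the coefficients `T_{jk̄}` in the chart `e` -/
  coeff : (e : HolChart n X) → Fin n → Fin n → 𝓓'(e.image, ℂ)
  /-- Transformation under a coordinate change `τ`: with
  `T_{jk̄} = ∑ (T'_{ab̄} ∘ τ) ∂_jτ_a conj(∂_kτ_b)`, testing against `η` on the side of `e` amounts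
  to testing `T'_{ab̄}` against `θ_{ab} = (∂_jτ_a conj(∂_kτ_b) |det ∂τ|⁻² η) ∘ τ⁻¹`, extended by
  zero, whose real and imaginary parts are `α a b` and `β a b`. -/
  compat : ∀ e e' : HolChart n X, ∀ j k : Fin n, ∀ η : 𝓓(e.image, ℝ),
    tsupport η ⊆ e.overlap e' →
    ∀ α β : Fin n → Fin n → 𝓓(e'.image, ℝ),
    (∀ a b, ∀ z ∈ e.overlap e',
      (α a b (e.transition e' z) : ℂ) + Complex.I * (β a b (e.transition e' z) : ℂ) =
        e.jacobian e' z a j * conj (e.jacobian e' z b k) *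
          ((‖(e.jacobian e' z).det‖ ^ 2)⁻¹ : ℝ) * (η z : ℂ)) →
    (∀ a b, ∀ w, w ∉ e'.overlap e → α a b w = 0 ∧ β a b w = 0) →
    coeff e j k η =
      ∑ a, ∑ b, (coeff e' a b (α a b) + Complex.I * coeff e' a b (β a b))
  /-- positivity: `∑ T_{jk̄} ξ_j conj(ξ_k)` is a positive distribution for each `ξ ∈ ℂⁿ` -/
  positive : ∀ e : HolChart n X, ∀ η : 𝓓(e.image, ℝ), (∀ z, 0 ≤ η z) →
    (Matrix.of fun j k => coeff e j k η).PosSemidef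
  closed : ∀ e : HolChart n X, ∀ j k l : Fin n, ∀ η : 𝓓(e.image, ℝ),
    wirtingerDist l (coeff e j k) η = wirtingerDist j (coeff e l k) η
  closedBar : ∀ e : HolChart n X, ∀ j k l : Fin n, ∀ η : 𝓓(e.image, ℝ),
    wirtingerBarDist l (coeff e j k) η = wirtingerBarDist k (coeff e j l) η

end Manifold

/-! ### Plurisubharmonic functions and local potentials -/

/-- The mean of `φ` over the circle `{z + e^{2πit} w}`, as the Lebesgue integral of the positive part
minus that of the negative part. -/
def circleMean {n : ℕ} (φ : Cn n → EReal) (z w : Cn n) : EReal :=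
  ((∫⁻ t in Set.Ioc (0 : ℝ) 1,
    (φ (z + Complex.exp (2 * Real.pi * t * Complex.I) • w)).toENNReal : ENNReal) : EReal) -
  ((∫⁻ t in Set.Ioc (0 : ℝ) 1,
    (-φ (z + Complex.exp (2 * Real.pi * t * Complex.I) • w)).toENNReal : ENNReal) : EReal)

/-- `φ : U → [-∞, ∞)` is upper semicontinuous and satisfies the sub-mean value inequality on every
closed complex disc contained in the open set `U`. -/
structure IsPsh {n : ℕ} (φ : Cn n → EReal) (U : Set (Cn n)) : Prop where
  usc : UpperSemicontinuousOn φ U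
  lt_top : ∀ z ∈ U, φ z < ⊤
  submean : ∀ z w : Cn n, (∀ t : ℂ, ‖t‖ ≤ 1 → z + t • w ∈ U) → φ z ≤ circleMean φ z w

section Main

variable {n : ℕ} {X : Type*} [TopologicalSpace X] [ChartedSpace (Cn n) X]

/-- `φ` is an (upper semicontinuous, plurisubharmonic) local potential of `χ` on the open subset `U`
of the image of the chart `e`: `φ` is in `L¹_loc` and `√-1 ∂∂̄ φ = χ` on `U` as currents. -/
structure IsLocalPotential (χ : ClosedPositiveCurrent n X) (e : HolChart n X)
    (U : Set (Cn n)) (φ : Cn n → EReal) : Prop where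
  psh : IsPsh φ U
  ne_bot : ∀ᵐ z ∂(volume.restrict U), φ z ≠ ⊥
  locInt : LocallyIntegrableOn (fun z => (φ z).toReal) U volume
  ddbar : ∀ j k : Fin n, ∀ η : 𝓓(e.image, ℝ), tsupport η ⊆ U →
    ∫ z in U, ((φ z).toReal : ℂ) * complexHessian η z j k = χ.coeff e j k η

/-- `q` is an upper test of `φ` at `x`: it is `C²` on the neighbourhood `V` of `x`, `q ≥ φ` on `V`
and `q(x) = φ(x)`. -/
structure IsUpperTest (φ : Cn n → EReal) (x : Cn n) (V : Set (Cn n)) (q : Cn n → ℝ) :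
    Prop where
  isOpen : IsOpen V
  mem : x ∈ V
  smooth : ContDiffOn ℝ 2 q V
  le : ∀ y ∈ V, φ y ≤ (q y : EReal)
  eq : φ x = (q x : EReal)

/-- `P_ω(χ) ≤_v c`: for every coordinate neighbourhood, every local potential `φ` of `χ` on it, every
point `x` of it and every upper test `q` of `φ` at `x`, one has `P_ω(√-1 ∂∂̄ q)(x) ≤ c`. -/
def IsViscositySubsolution (ω : KahlerForm n X) (χ : ClosedPositiveCurrent n X) (c : ℝ) :
    Prop :=
  ∀ (e : HolChart n X) (U : Set (Cn n)), IsOpen U → U ⊆ e.1.target →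
    ∀ φ : Cn n → EReal, IsLocalPotential χ e U φ →
    ∀ x ∈ U, ∀ V : Set (Cn n), V ⊆ U → ∀ q : Cn n → ℝ, IsUpperTest φ x V q →
      (opP (ω.coeff e x) (complexHessian q x) : EReal) ≤ (c : EReal)

/-- A mollifier: smooth, nonnegative, vanishing outside the unit ball, of integral one. -/
structure IsMollifier (ρ : Cn n → ℝ) : Prop where
  smooth : ContDiff ℝ ((⊤ : ℕ∞) : WithTop ℕ∞) ρ
  nonneg : ∀ w, 0 ≤ ρ w
  support : ∀ w, 1 < ‖w‖ → ρ w = 0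
  integral : ∫ w, ρ w = 1

/-- The regularization `φ_δ(z) = ∫ φ(z - δ w) ρ(w) dw`. -/
def regularization (ρ : Cn n → ℝ) (φ : Cn n → EReal) (δ : ℝ) (z : Cn n) : ℝ :=
  ∫ w, (φ (z - δ • w)).toReal * ρ w

/-- `χ ∈ Γ̄_{ω,c}`, with regularizations by the mollifier `ρ`: for every open subset `O` of a
coordinate neighbourhood, every Kähler form `ω₀ ≤ ω` with constant coefficients `B` on `O`, every
local potential `φ` of `χ` on `O` and every `δ > 0`, one has `P_{ω₀}(√-1 ∂∂̄ φ_δ) ≤ c` on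
`O_δ = {z ∈ O | d(z, ∂O) > δ}`, the set of all `z` whose closed `δ`-ball lies in `O`. -/
def MemGammaBar (ρ : Cn n → ℝ) (ω : KahlerForm n X) (c : ℝ) (χ : ClosedPositiveCurrent n X) :
    Prop :=
  ∀ (e : HolChart n X) (O : Set (Cn n)), IsOpen O → O ⊆ e.1.target →
    ∀ B : Matrix (Fin n) (Fin n) ℂ, B.PosDef → (∀ z ∈ O, (ω.coeff e z - B).PosSemidef) →
    ∀ φ : Cn n → EReal, IsLocalPotential χ e O φ →
    ∀ δ : ℝ, 0 < δ → ∀ z : Cn n, Metric.closedBall z δ ⊆ O →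
      (opP B (complexHessian (regularization ρ φ δ) z) : EReal) ≤ (c : EReal)

end Main

end

/-!
The operator `P_B` is a supremum of affine functions: for positive definite `B` and Hermitian `A`,
`P_B(A) ≤ c` means `2 Re tr(Y* S) ≤ c + Re tr(Y* A Y)` for all `n × (n - 1)` matrices `S`, `Y` with
`S S* ≤ B` (`opP_le_iff`). For fixed `S` and `Y` and `A = √-1 ∂∂̄ q`, the term `Re tr(Y* A Y)` is a
sum of second directional derivatives of `q`, a degenerate elliptic operator `L` with constant
coefficients (`re_trace_complexHessian`). So both conditions are families of inequalities `L q ≥ b`,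
the first one for upper tests, the second one for regularizations.

From viscosity to regularizations: since `B ≤ ω`, a local potential `φ` is a viscosity subsolution
of each equation `L φ = b`. Convolution preserves this because `L` is linear with constant
coefficients, but the argument needs an integral form of the inequality. It is provided by a
probability measure on the unit sphere which represents the value at the origin of every polynomial
solution of `L h = 0`, obtained from the maximum principle and the theorems of M. Riesz and
Riesz–Markov–Kakutani (`exists_harmonicMeasure`). Since the Dirichlet problem with polynomial data on
the sphere has polynomial solutions (`exists_sumSqPoly_eq_zero_of_sphere`), comparison with these
gives the mean value inequality for `φ` (`IsHarmonicMeasure.le_integral`). It survives convolution,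
and for the `C²` function `φ_δ` it forces `L φ_δ ≥ b` (`IsMollifier.le_sumSqDeriv_regularization`).
The case `Y = 0` is the inequality `0 ≤ c`, which holds because upper tests exist.

From regularizations to viscosity: on a small ball about `x` the constant form `(1 - ε) ω(x)` lies
below `ω`. If `q` is an upper test at `x`, then near `x` there are points where the difference of
`φ_δ` and the strict test `q + ε|· - x|²` has a local maximum, for otherwise `φ` would lie below the
test by a fixed amount almost everywhere near `x`, which plurisubharmonicity excludes
(`IsMollifier.exists_sumSqDeriv_regularization_le`). There `L φ_δ` is at most `L q` plus a multiple
of `ε`, and `ε → 0` gives the inequality at `x`.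
-/

/-! ### Second derivatives along a family of vectors -/

section SecondDerivatives

variable {E : Type*} [NormedAddCommGroup E] [NormedSpace ℝ E]

/-- The constant-coefficient operator `f ↦ ∑ k, D²f(v k, v k)`, a possibly degenerate elliptic
operator of second order. -/
noncomputable def sumSqDeriv {κ : Type*} [Fintype κ] (v : κ → E) (f : E → ℝ) (x : E) : ℝ :=
  ∑ k, fderiv ℝ (fderiv ℝ f) x (v k) (v k)

theorem ContDiffAt.differentiableAt_fderiv_of_two {f : E → ℝ} {x : E} (hf : ContDiffAt ℝ 2 f x) :
    DifferentiableAt ℝ (fderiv ℝ f) x :=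
  (hf.fderiv_right (m := 1) (by norm_num)).differentiableAt (by norm_num)

theorem ContDiffAt.eventually_differentiableAt_of_two {f : E → ℝ} {x : E}
    (hf : ContDiffAt ℝ 2 f x) : ∀ᶠ y in nhds x, DifferentiableAt ℝ f y :=
  (hf.eventually (by simp)).mono fun _ hy => hy.differentiableAt (by norm_num)

theorem ContDiffAt.fderiv_fderiv_comm {f : E → ℝ} {x : E} (hf : ContDiffAt ℝ 2 f x) (u w : E) :
    fderiv ℝ (fderiv ℝ f) x u w = fderiv ℝ (fderiv ℝ f) x w u :=
  hf.isSymmSndFDerivAt (by simp) u w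

theorem IsLocalMax.fderiv_fderiv_nonpos {f : E → ℝ} {x : E} (h : IsLocalMax f x)
    (hf : ContDiffAt ℝ 2 f x) (v : E) : fderiv ℝ (fderiv ℝ f) x v v ≤ 0 := by
  by_contra! hpos
  set γ : ℝ → E := fun t => x + t • v with hγ
  have hγ0 : γ 0 = x := by simp [hγ]
  have hγd : ∀ t, HasDerivAt γ v t := fun t => by
    simpa [hγ] using ((hasDerivAt_id t).smul_const v).const_add x
  have hγc : Filter.Tendsto γ (nhds 0) (nhds x) := by
    have := (hγd 0).continuousAt.tendsto
    rwa [hγ0] at this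
  have h1 : deriv (f ∘ γ) =ᶠ[nhds 0] fun t => fderiv ℝ f (γ t) v := by
    filter_upwards [hγc.eventually hf.eventually_differentiableAt_of_two] with t ht
    exact (ht.hasFDerivAt.comp_hasDerivAt t (hγd t)).deriv
  have h2 : deriv (deriv (f ∘ γ)) 0 = fderiv ℝ (fderiv ℝ f) x v v := by
    rw [h1.deriv_eq]
    have hd : HasFDerivAt (fderiv ℝ f) (fderiv ℝ (fderiv ℝ f) x) (γ 0) := by
      rw [hγ0]; exact hf.differentiableAt_fderiv_of_two.hasFDerivAt
    have := (hd.comp_hasDerivAt 0 (hγd 0)).clm_apply (hasDerivAt_const (0 : ℝ) v)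
    simpa using this.deriv
  have hmax : IsLocalMax (f ∘ γ) 0 := by
    have := hγc.eventually h
    filter_upwards [this] with t ht
    simpa [hγ0] using ht
  have hc : ContinuousAt (f ∘ γ) 0 := by
    refine ContinuousAt.comp ?_ (hγd 0).continuousAt
    rw [hγ0]; exact hf.continuousAt
  have hmin := isLocalMin_of_deriv_deriv_pos (h2 ▸ hpos) hmax.deriv_eq_zero hc
  -- a function with a local maximum and a local minimum at `0` is locally constant
  have hconst : f ∘ γ =ᶠ[nhds 0] fun _ => f x := by
    filter_upwards [hmax, hmin] with t ht1 ht2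
    have := le_antisymm ht1 ht2
    simpa [hγ0] using this
  have h3 : deriv (deriv (f ∘ γ)) 0 = 0 := by
    rw [hconst.deriv.deriv_eq]; simp
  linarith

theorem ContDiffAt.fderiv_fderiv_add {f g : E → ℝ} {x : E} (hf : ContDiffAt ℝ 2 f x)
    (hg : ContDiffAt ℝ 2 g x) :
    fderiv ℝ (fderiv ℝ (fun y => f y + g y)) x
      = fderiv ℝ (fderiv ℝ f) x + fderiv ℝ (fderiv ℝ g) x := by
  have : fderiv ℝ (fun y => f y + g y) =ᶠ[nhds x] fun y => fderiv ℝ f y + fderiv ℝ g y := by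
    filter_upwards [hf.eventually_differentiableAt_of_two,
      hg.eventually_differentiableAt_of_two] with y h1 h2
    exact fderiv_fun_add h1 h2
  rw [this.fderiv_eq]
  exact fderiv_fun_add hf.differentiableAt_fderiv_of_two hg.differentiableAt_fderiv_of_two

theorem fderiv_fderiv_fun_neg (f : E → ℝ) (x : E) :
    fderiv ℝ (fderiv ℝ (fun y => -f y)) x = -fderiv ℝ (fderiv ℝ f) x := by
  have : fderiv ℝ (fun y => -f y) = fun y => -fderiv ℝ f y := by
    funext y; exact fderiv_fun_neg
  rw [this]; exact fderiv_fun_neg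

variable {κ : Type*} [Fintype κ] (v : κ → E)

theorem sumSqDeriv_add {f g : E → ℝ} {x : E} (hf : ContDiffAt ℝ 2 f x)
    (hg : ContDiffAt ℝ 2 g x) :
    sumSqDeriv v (fun y => f y + g y) x = sumSqDeriv v f x + sumSqDeriv v g x := by
  simp [sumSqDeriv, hf.fderiv_fderiv_add hg, Finset.sum_add_distrib]

theorem sumSqDeriv_neg (f : E → ℝ) (x : E) :
    sumSqDeriv v (fun y => -f y) x = -sumSqDeriv v f x := by
  simp [sumSqDeriv, fderiv_fderiv_fun_neg]

theorem sumSqDeriv_add_const (f : E → ℝ) (a : ℝ) (x : E) :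
    sumSqDeriv v (fun y => f y + a) x = sumSqDeriv v f x := by
  have : fderiv ℝ (fun y => f y + a) = fderiv ℝ f := by
    funext y; exact fderiv_add_const a
  simp [sumSqDeriv, this]

/-- Comparison of the operator on two functions one of which touches the other from above. -/
theorem sumSqDeriv_le_of_isLocalMax_sub {f g : E → ℝ} {x : E} (hf : ContDiffAt ℝ 2 f x)
    (hg : ContDiffAt ℝ 2 g x) (h : IsLocalMax (fun y => f y - g y) x) :
    sumSqDeriv v f x ≤ sumSqDeriv v g x := by
  simp only [sub_eq_add_neg] at h
  have := sumSqDeriv_add v hf hg.neg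
  have hle : sumSqDeriv v (fun y => f y + -g y) x ≤ 0 :=
    Finset.sum_nonpos fun k _ => h.fderiv_fderiv_nonpos (hf.add hg.neg) (v k)
  have h3 := sumSqDeriv_neg v g x
  change sumSqDeriv v (fun y => f y + -g y) x = _ + sumSqDeriv v (fun y => -g y) x at this
  linarith

theorem ContDiffOn.continuousOn_sumSqDeriv {f : E → ℝ} {V : Set E} (hV : IsOpen V)
    (hf : ContDiffOn ℝ 2 f V) : ContinuousOn (sumSqDeriv v f) V := by
  have h1 : ContDiffOn ℝ 1 (fderiv ℝ f) V := hf.fderiv_of_isOpen hV (by norm_num)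
  have h2 : ContinuousOn (fderiv ℝ (fderiv ℝ f)) V := h1.continuousOn_fderiv_of_isOpen hV le_rfl
  unfold sumSqDeriv
  fun_prop

theorem Filter.EventuallyEq.sumSqDeriv_eq {f g : E → ℝ} {x : E} (h : f =ᶠ[nhds x] g) :
    sumSqDeriv v f x = sumSqDeriv v g x := by
  simp [sumSqDeriv, h.fderiv.fderiv_eq]

end SecondDerivatives

/-! ### Real coordinates and polynomial functions on `ℂⁿ` -/

section Polynomials

open MvPolynomial

/-- The real and imaginary parts of the coordinates, as real coordinates on `ℂⁿ`. -/
noncomputable def realCoord (n : ℕ) : Cn n ≃L[ℝ] (Fin n ⊕ Fin n → ℝ) :=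
  LinearEquiv.toContinuousLinearEquiv
    { toFun := fun z => Sum.elim (fun i => (z i).re) (fun i => (z i).im)
      invFun := fun x => WithLp.toLp 2 fun i => ⟨x (Sum.inl i), x (Sum.inr i)⟩
      map_add' := fun z w => by ext (i | i) <;> simp
      map_smul' := fun r z => by ext (i | i) <;> simp
      left_inv := fun z => by ext i; simp
      right_inv := fun x => by ext (i | i) <;> simp }

variable {n : ℕ}

@[simp] theorem realCoord_inl (z : Cn n) (i : Fin n) : realCoord n z (Sum.inl i) = (z i).re := rfl

@[simp] theorem realCoord_inr (z : Cn n) (i : Fin n) : realCoord n z (Sum.inr i) = (z i).im := rfl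

theorem sum_realCoord_sq (z : Cn n) : ∑ i, realCoord n z i ^ 2 = ‖z‖ ^ 2 := by
  rw [EuclideanSpace.norm_sq_eq, Fintype.sum_sum_type, ← Finset.sum_add_distrib]
  refine Finset.sum_congr rfl fun i _ => ?_
  rw [← Complex.normSq_eq_norm_sq, Complex.normSq_apply]
  simp [sq]

/-- Real polynomials on `ℂⁿ`, in the coordinates `realCoord`. -/
abbrev RealPoly (n : ℕ) : Type := MvPolynomial (Fin n ⊕ Fin n) ℝ

/-- The polynomial function `y ↦ p (s (y - a))`. -/
noncomputable def polyFun (a : Cn n) (s : ℝ) (p : RealPoly n) (y : Cn n) : ℝ :=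
  eval (realCoord n (s • (y - a))) p

/-- The derivative of a polynomial in the direction `v`. -/
noncomputable def dirDeriv (v : Cn n) : Derivation ℝ (RealPoly n) (RealPoly n) :=
  mkDerivation ℝ fun i => C (realCoord n v i)

theorem polyFun_C (a : Cn n) (s r : ℝ) (y : Cn n) : polyFun a s (C r) y = r := by simp [polyFun]

theorem polyFun_add (a : Cn n) (s : ℝ) (p q : RealPoly n) (y : Cn n) :
    polyFun a s (p + q) y = polyFun a s p y + polyFun a s q y := map_add _ _ _

theorem polyFun_sub (a : Cn n) (s : ℝ) (p q : RealPoly n) (y : Cn n) :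
    polyFun a s (p - q) y = polyFun a s p y - polyFun a s q y := map_sub _ _ _

theorem polyFun_mul (a : Cn n) (s : ℝ) (p q : RealPoly n) (y : Cn n) :
    polyFun a s (p * q) y = polyFun a s p y * polyFun a s q y := map_mul _ _ _

theorem polyFun_X (a : Cn n) (s : ℝ) (i : Fin n ⊕ Fin n) (y : Cn n) :
    polyFun a s (X i) y = realCoord n (s • (y - a)) i := eval_X _

theorem contDiff_polyFun (a : Cn n) (s : ℝ) (p : RealPoly n) {N : WithTop ℕ∞} :
    ContDiff ℝ N (polyFun a s p) := by
  have hX : ∀ i, ContDiff ℝ N fun y : Cn n => realCoord n (s • (y - a)) i := fun i => by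
    have h0 : ContDiff ℝ N fun y : Cn n => s • (y - a) :=
      (contDiff_id.sub contDiff_const).const_smul s
    have h1 : ContDiff ℝ N fun y : Cn n => realCoord n (s • (y - a)) :=
      (realCoord n).contDiff.comp h0
    exact (contDiff_pi.1 h1) i
  induction p using MvPolynomial.induction_on with
  | C r =>
    rw [funext (polyFun_C a s r)]
    exact contDiff_const
  | add p q hp hq =>
    rw [funext (polyFun_add a s p q)]
    exact hp.add hq
  | mul_X p i hp =>
    rw [funext (polyFun_mul a s p _), funext (polyFun_X a s i)]
    exact hp.mul (hX i)

theorem fderiv_polyFun (a : Cn n) (s : ℝ) (p : RealPoly n) (y v : Cn n) :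
    fderiv ℝ (polyFun a s p) y v = s * polyFun a s (dirDeriv v p) y := by
  have hdiff : ∀ p : RealPoly n, DifferentiableAt ℝ (polyFun a s p) y := fun p =>
    (contDiff_polyFun a s p (N := 1)).differentiable (by norm_num) y
  induction p using MvPolynomial.induction_on with
  | C r =>
    have : polyFun a s (C r) = fun _ => r := by funext y; simp [polyFun]
    rw [this]
    simp [polyFun, dirDeriv]
  | add p q hp hq =>
    have : polyFun a s (p + q) = fun y => polyFun a s p y + polyFun a s q y := by
      funext y; simp [polyFun]
    rw [this, fderiv_fun_add (hdiff p) (hdiff q)]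
    simp only [_root_.add_apply, hp, hq, map_add]
    simp [polyFun, mul_add]
  | mul_X p i hp =>
    have : polyFun a s (p * X i) = fun y => polyFun a s p y * polyFun a s (X i) y := by
      funext y; simp [polyFun]
    rw [this, fderiv_fun_mul (hdiff p) (hdiff (X i))]
    have hXi : fderiv ℝ (polyFun a s (X i)) y v = s * realCoord n v i := by
      set g : Cn n →L[ℝ] ℝ := ContinuousLinearMap.proj (R := ℝ) i ∘L
          (realCoord n : Cn n →L[ℝ] (Fin n ⊕ Fin n → ℝ)) with hg
      have e : polyFun a s (X i) = fun y => g (s • (y - a)) := funext (polyFun_X a s i)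
      have h1 : HasFDerivAt (fun y : Cn n => s • (y - a)) (s • ContinuousLinearMap.id ℝ (Cn n)) y :=
        ((hasFDerivAt_id y).sub_const a).const_smul s
      have h2 : HasFDerivAt (fun y : Cn n => g (s • (y - a)))
          (g ∘L (s • ContinuousLinearMap.id ℝ (Cn n))) y := g.hasFDerivAt.comp y h1
      rw [e, h2.fderiv]
      simp [hg]
    simp only [_root_.add_apply, _root_.smul_apply, hXi, hp,
      Derivation.leibniz]
    simp [polyFun, dirDeriv, mkDerivation_X]
    ring

variable {κ : Type*} [Fintype κ] (v : κ → Cn n)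

/-- The operator `sumSqDeriv v` on polynomials. -/
noncomputable def sumSqPoly : RealPoly n →ₗ[ℝ] RealPoly n :=
  ∑ k, (dirDeriv (v k)).toLinearMap ∘ₗ (dirDeriv (v k)).toLinearMap

theorem sumSqPoly_apply (p : RealPoly n) :
    sumSqPoly v p = ∑ k, dirDeriv (v k) (dirDeriv (v k) p) := by
  simp [sumSqPoly]

theorem sumSqDeriv_polyFun (a : Cn n) (s : ℝ) (p : RealPoly n) (y : Cn n) :
    sumSqDeriv v (polyFun a s p) y = s ^ 2 * polyFun a s (sumSqPoly v p) y := by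
  have key : ∀ u : Cn n, fderiv ℝ (fderiv ℝ (polyFun a s p)) y u u
      = s ^ 2 * polyFun a s (dirDeriv u (dirDeriv u p)) y := fun u => by
    have hd : DifferentiableAt ℝ (fderiv ℝ (polyFun a s p)) y :=
      (contDiff_polyFun a s p).contDiffAt.differentiableAt_fderiv_of_two
    have h1 : fderiv ℝ (fun y => fderiv ℝ (polyFun a s p) y u) y u
        = fderiv ℝ (fderiv ℝ (polyFun a s p)) y u u := by
      rw [fderiv_clm_apply hd (differentiableAt_const u)]
      simp
    rw [← h1]
    have h2 : (fun y => fderiv ℝ (polyFun a s p) y u)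
        = fun y => s * polyFun a s (dirDeriv u p) y := by
      funext y; exact fderiv_polyFun a s p y u
    rw [h2, fderiv_const_mul
      ((contDiff_polyFun a s _ (N := 1)).differentiable (by norm_num) y)]
    simp only [_root_.smul_apply, fderiv_polyFun, smul_eq_mul]
    ring
  simp only [sumSqDeriv, key, sumSqPoly_apply]
  rw [← Finset.mul_sum]
  simp [polyFun]

/-- The polynomial `|z|²`. -/
noncomputable def normSqPoly (n : ℕ) : RealPoly n := ∑ i, X i ^ 2

theorem polyFun_normSqPoly (a : Cn n) (s : ℝ) (y : Cn n) :
    polyFun a s (normSqPoly n) y = ‖s • (y - a)‖ ^ 2 := by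
  rw [← sum_realCoord_sq]
  simp only [polyFun, normSqPoly, map_sum, map_pow, eval_X]

theorem sumSqPoly_normSqPoly : sumSqPoly v (normSqPoly n) = C (2 * ∑ k, ‖v k‖ ^ 2) := by
  have key : ∀ u : Cn n, dirDeriv u (dirDeriv u (normSqPoly n)) = C (2 * ‖u‖ ^ 2) := fun u => by
    have h1 : ∀ i, dirDeriv u (X i) = C (realCoord n u i) := fun i => mkDerivation_X _ _ _
    have h2 : ∀ r, dirDeriv u (C r) = 0 := fun r => derivation_C _ _
    rw [← sum_realCoord_sq, normSqPoly]
    simp only [sq, map_sum, Derivation.leibniz, h1, map_add, h2, smul_eq_mul, mul_zero, zero_add,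
      map_mul, Finset.mul_sum]
    refine Finset.sum_congr rfl fun i _ => ?_
    have : (C 2 : RealPoly n) = 2 := map_ofNat C 2
    rw [this]; ring
  simp only [sumSqPoly_apply, key, map_mul, map_sum, Finset.mul_sum]

theorem totalDegree_dirDeriv_le (u : Cn n) (p : RealPoly n) :
    (dirDeriv u p).totalDegree ≤ p.totalDegree - 1 := by
  have hmon : ∀ (s : Fin n ⊕ Fin n →₀ ℕ) (r : ℝ),
      (dirDeriv u (monomial s r)).totalDegree ≤ s.degree - 1 := fun s r => by
    rw [dirDeriv, mkDerivation_monomial]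
    refine (totalDegree_smul_le _ _).trans ?_
    refine totalDegree_finsetSum_le fun i hi => ?_
    have hi' : 1 ≤ s i := Nat.one_le_iff_ne_zero.2 (by simpa using hi)
    simp only [smul_eq_mul]
    refine (totalDegree_mul _ _).trans ?_
    rw [totalDegree_C, add_zero]
    refine (totalDegree_monomial_le _ _).trans ?_
    have h1 : s - Finsupp.single i 1 + Finsupp.single i 1 = s :=
      tsub_add_cancel_of_le (by simpa using hi')
    have h2 := congrArg Finsupp.degree h1
    rw [map_add, Finsupp.degree_single] at h2
    change (s - Finsupp.single i 1).degree ≤ _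
    omega
  conv_lhs => rw [p.as_sum, map_sum]
  refine totalDegree_finsetSum_le fun s hs => (hmon s _).trans ?_
  exact Nat.sub_le_sub_right (le_totalDegree hs) 1

theorem totalDegree_sumSqPoly_le (p : RealPoly n) :
    (sumSqPoly v p).totalDegree ≤ p.totalDegree - 2 := by
  rw [sumSqPoly_apply]
  refine totalDegree_finsetSum_le fun k _ => (totalDegree_dirDeriv_le _ _).trans ?_
  have := totalDegree_dirDeriv_le (v k) p
  omega

/-- A polynomial that vanishes on the unit ball is zero. -/
theorem eq_zero_of_polyFun_eq_zero {p : RealPoly n}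
    (h : ∀ y : Cn n, ‖y‖ < 1 → polyFun 0 1 p y = 0) : p = 0 := by
  set e : ℝ := ((Fintype.card (Fin n ⊕ Fin n) : ℝ) + 1)⁻¹ with he
  have hepos : 0 < e := by positivity
  refine funext_set (fun _ => Set.Ioo 0 e) (fun _ => Set.Ioo_infinite hepos) fun x hx => ?_
  have hx' : ∀ i, 0 < x i ∧ x i < e := fun i => hx i trivial
  have hle1 : e ≤ 1 := inv_le_one_of_one_le₀ (by
    have : (0 : ℝ) ≤ Fintype.card (Fin n ⊕ Fin n) := by positivity
    linarith)
  have := h ((realCoord n).symm x) (by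
    have h2 : ‖(realCoord n).symm x‖ ^ 2 < 1 := by
      rw [← sum_realCoord_sq]
      simp only [ContinuousLinearEquiv.apply_symm_apply]
      calc ∑ i, x i ^ 2 ≤ ∑ i : Fin n ⊕ Fin n, e := by
            refine Finset.sum_le_sum fun i _ => ?_
            have := hx' i
            nlinarith
        _ < 1 := by
            rw [Finset.sum_const, Finset.card_univ, nsmul_eq_mul, he, ← div_eq_mul_inv,
              div_lt_one (by positivity)]
            linarith
    nlinarith [norm_nonneg ((realCoord n).symm x)])
  simpa [polyFun] using this

end Polynomials

/-! ### Upper tests and the comparison principle -/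

section Comparison

variable {n : ℕ}

/-- An upper semicontinuous function that lies below `h` on a sphere but not in the ball is touched
from above by a translate of `h` at a point of the open ball. -/
theorem exists_isUpperTest_of_lt {φ : Cn n → EReal} {a : Cn n} {r : ℝ}
    (husc : UpperSemicontinuousOn φ (Metric.closedBall a r))
    (hlt : ∀ z ∈ Metric.closedBall a r, φ z < ⊤) {h : Cn n → ℝ} (hh : ContDiff ℝ 2 h)
    (hs : ∀ y, dist y a = r → φ y ≤ (h y : EReal)) {y₀ : Cn n}
    (hy₀ : y₀ ∈ Metric.closedBall a r) (hlt₀ : (h y₀ : EReal) < φ y₀) :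
    ∃ x ∈ Metric.ball a r, ∃ m : ℝ,
      IsUpperTest φ x (Metric.ball a r) fun y => h y + m := by
  have hcont : Continuous fun y => ((-h y : ℝ) : EReal) :=
    continuous_coe_real_ereal.comp hh.continuous.neg
  have husc' : UpperSemicontinuousOn (fun y => φ y + ((-h y : ℝ) : EReal))
      (Metric.closedBall a r) :=
    husc.add' (hcont.upperSemicontinuous.upperSemicontinuousOn _) fun y _ =>
      EReal.continuousAt_add (Or.inr (EReal.coe_ne_bot _)) (Or.inr (EReal.coe_ne_top _))
  obtain ⟨x, hx, hmax⟩ := husc'.exists_isMaxOn ⟨y₀, hy₀⟩ (isCompact_closedBall a r)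
  have hpos : (0 : EReal) < φ x + ((-h x : ℝ) : EReal) := by
    refine lt_of_lt_of_le ?_ (hmax hy₀)
    have h1 : φ y₀ ≠ ⊤ := (hlt y₀ hy₀).ne
    change (0 : EReal) < φ y₀ + ((-h y₀ : ℝ) : EReal)
    induction hφ : φ y₀ with
    | bot => simp [hφ] at hlt₀
    | top => exact absurd hφ h1
    | coe t =>
      rw [hφ] at hlt₀
      have : h y₀ < t := by exact_mod_cast hlt₀
      rw [← EReal.coe_add]
      exact_mod_cast (by linarith : (0 : ℝ) < t + -h y₀)
  obtain ⟨t, ht⟩ : ∃ t : ℝ, φ x = t := by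
    induction hφ : φ x with
    | bot => simp [hφ] at hpos
    | top => exact absurd hφ (hlt x hx).ne
    | coe t => exact ⟨t, rfl⟩
  have hxt : h x < t := by
    rw [ht, ← EReal.coe_add] at hpos
    have : (0 : ℝ) < t + -h x := by exact_mod_cast hpos
    linarith
  have hxball : x ∈ Metric.ball a r := by
    refine lt_of_le_of_ne (Metric.mem_closedBall.1 hx) fun heq => ?_
    have := hs x heq
    rw [ht] at this
    exact absurd hxt (not_lt.2 (by exact_mod_cast this))
  refine ⟨x, hxball, t - h x, Metric.isOpen_ball, hxball,
    (hh.add contDiff_const).contDiffOn, fun y hy => ?_, ?_⟩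
  · have hy1 : φ y + ((-h y : ℝ) : EReal) ≤ φ x + ((-h x : ℝ) : EReal) :=
      hmax (Metric.ball_subset_closedBall hy)
    induction hφ : φ y with
    | bot => exact bot_le
    | top => exact absurd hφ (hlt y (Metric.ball_subset_closedBall hy)).ne
    | coe u =>
      rw [hφ, ht, ← EReal.coe_add, ← EReal.coe_add] at hy1
      have : u + -h y ≤ t + -h x := by exact_mod_cast hy1
      exact_mod_cast (by linarith : u ≤ h y + (t - h x))
  · rw [ht]; congr 1; ring

variable {κ : Type*} [Fintype κ] {v : κ → Cn n}

theorem IsUpperTest.sumSqDeriv_le {f q : Cn n → ℝ} {x : Cn n} {V : Set (Cn n)}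
    (h : IsUpperTest (fun y => (f y : EReal)) x V q) (hf : ContDiffAt ℝ 2 f x) :
    sumSqDeriv v f x ≤ sumSqDeriv v q x := by
  have hV := h.isOpen.mem_nhds h.mem
  refine sumSqDeriv_le_of_isLocalMax_sub v hf (h.smooth.contDiffAt hV) ?_
  filter_upwards [hV] with y hy
  have h1 : f y ≤ q y := by exact_mod_cast h.le y hy
  have h2 : f x = q x := by exact_mod_cast h.eq
  linarith

theorem sum_norm_sq_pos (hv : ∃ k, v k ≠ 0) : 0 < 2 * ∑ k, ‖v k‖ ^ 2 := by
  obtain ⟨k, hk⟩ := hv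
  have : 0 < ‖v k‖ ^ 2 := by positivity
  have h2 := Finset.single_le_sum (f := fun k => ‖v k‖ ^ 2) (fun k _ => by positivity)
    (Finset.mem_univ k)
  linarith

open MvPolynomial in
/-- Comparison principle: a viscosity subsolution of `sumSqDeriv v φ ≥ b` in a ball lies below every
polynomial solution of `sumSqDeriv v h = b` that dominates it on the boundary sphere. -/
theorem le_polyFun_of_viscosity (hv : ∃ k, v k ≠ 0) {φ : Cn n → EReal} {a : Cn n} {r : ℝ}
    (hr : 0 < r) (husc : UpperSemicontinuousOn φ (Metric.closedBall a r))
    (hlt : ∀ z ∈ Metric.closedBall a r, φ z < ⊤) {b : ℝ}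
    (htest : ∀ x ∈ Metric.ball a r, ∀ V ⊆ Metric.ball a r, ∀ q, IsUpperTest φ x V q →
      b ≤ sumSqDeriv v q x)
    {H : RealPoly n} (hH : sumSqPoly v H = C (b * r ^ 2))
    (hs : ∀ y, dist y a = r → φ y ≤ (polyFun a r⁻¹ H y : EReal)) :
    ∀ y ∈ Metric.closedBall a r, φ y ≤ (polyFun a r⁻¹ H y : EReal) := by
  intro y₀ hy₀
  by_contra! hcon
  obtain ⟨t, ht1, ht2⟩ := EReal.lt_iff_exists_real_btwn.1 hcon
  obtain ⟨ε, hε⟩ : ∃ ε, ε = t - polyFun a r⁻¹ H y₀ := ⟨_, rfl⟩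
  have hεpos : 0 < ε := hε ▸ sub_pos.2 (by exact_mod_cast ht1)
  -- perturbing by `ε (1 - |z|²)` makes the inequality for the comparison function strict
  set G : RealPoly n := H + C ε * (1 - normSqPoly n) with hG
  have hGval : ∀ y, polyFun a r⁻¹ G y
      = polyFun a r⁻¹ H y + ε * (1 - ‖r⁻¹ • (y - a)‖ ^ 2) := fun y => by
    rw [hG, polyFun_add, polyFun_mul, polyFun_C, polyFun_sub, polyFun_normSqPoly, ← C_1, polyFun_C]
  have hnorm : ∀ y, ‖r⁻¹ • (y - a)‖ = r⁻¹ * dist y a := fun y => by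
    rw [norm_smul, Real.norm_of_nonneg (inv_pos.2 hr).le, dist_eq_norm]
  obtain ⟨x, hx, m, hm⟩ := exists_isUpperTest_of_lt husc hlt (contDiff_polyFun a r⁻¹ G)
    (fun y hy => by
      have : polyFun a r⁻¹ G y = polyFun a r⁻¹ H y := by
        rw [hGval, hnorm, hy, inv_mul_cancel₀ hr.ne']; ring
      rw [this]; exact hs y hy) hy₀ (by
      refine lt_of_le_of_lt ?_ ht2
      have h1 : 0 ≤ ε * ‖r⁻¹ • (y₀ - a)‖ ^ 2 := by positivity
      have : polyFun a r⁻¹ G y₀ ≤ t := by rw [hGval]; linarith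
      exact_mod_cast this)
  have h1 := htest x hx _ subset_rfl _ hm
  rw [sumSqDeriv_add_const, sumSqDeriv_polyFun] at h1
  have h2 : sumSqPoly v G = C (b * r ^ 2 - ε * (2 * ∑ k, ‖v k‖ ^ 2)) := by
    have h10 : sumSqPoly v 1 = 0 := by
      rw [sumSqPoly_apply]; simp
    have : C ε * (1 - normSqPoly n) = ε • (1 - normSqPoly n) := by rw [smul_eq_C_mul]
    rw [hG, this, map_add, map_smul, map_sub, h10, hH, sumSqPoly_normSqPoly, smul_eq_C_mul,
      C_sub, zero_sub, mul_neg, ← C_mul, sub_eq_add_neg]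
  rw [h2, polyFun_C] at h1
  have h3 := mul_pos hεpos (sum_norm_sq_pos hv)
  have h4 : 0 < r⁻¹ ^ 2 := by positivity
  have h5 : r⁻¹ ^ 2 * r ^ 2 = 1 := by rw [← mul_pow, inv_mul_cancel₀ hr.ne', one_pow]
  have h6 : r⁻¹ ^ 2 * (b * r ^ 2 - ε * (2 * ∑ k, ‖v k‖ ^ 2))
      = b * (r⁻¹ ^ 2 * r ^ 2) - r⁻¹ ^ 2 * (ε * (2 * ∑ k, ‖v k‖ ^ 2)) := by ring
  rw [h6, h5] at h1
  linarith [mul_pos h4 h3]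

open MvPolynomial in
/-- Maximum principle for polynomial solutions. -/
theorem polyFun_le_of_sphere (hv : ∃ k, v k ≠ 0) {g : RealPoly n} (hg : sumSqPoly v g = 0) {M : ℝ}
    (hM : ∀ w : Cn n, ‖w‖ = 1 → polyFun 0 1 g w ≤ M) {y : Cn n} (hy : ‖y‖ ≤ 1) :
    polyFun 0 1 g y ≤ M := by
  have hg2 := contDiff_polyFun 0 1 g (N := 2)
  have hM0 : sumSqPoly v (C M) = C (0 * (1 : ℝ) ^ 2) := by
    rw [sumSqPoly_apply]; simp
  have := le_polyFun_of_viscosity (φ := fun y => (polyFun 0 1 g y : EReal)) hv (a := 0)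
    one_pos
    ((continuous_coe_real_ereal.comp hg2.continuous).upperSemicontinuous.upperSemicontinuousOn _)
    (fun z _ => EReal.coe_lt_top _) (b := 0)
    (fun x _ V _ q hq => by
      have := hq.sumSqDeriv_le (v := v) hg2.contDiffAt
      rw [sumSqDeriv_polyFun, hg] at this
      simpa [polyFun] using this)
    hM0
    (fun y hy => by
      rw [polyFun_C]
      exact_mod_cast hM y (by simpa using hy))
    y (by simpa using hy)
  rw [polyFun_C] at this
  exact_mod_cast this

open MvPolynomial in
/-- The Dirichlet problem with polynomial data on the unit ball: every polynomial agrees on the unit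
sphere with a polynomial solution of `sumSqDeriv v h = 0`. By the maximum principle
`q ↦ sumSqPoly v ((1 - |z|²) q)` is injective on polynomials of degree at most `d`, hence
surjective, these being a finite-dimensional space. -/
theorem exists_sumSqPoly_eq_zero_of_sphere (hv : ∃ k, v k ≠ 0) (p : RealPoly n) :
    ∃ h : RealPoly n, sumSqPoly v h = 0 ∧
      ∀ w : Cn n, ‖w‖ = 1 → polyFun 0 1 h w = polyFun 0 1 p w := by
  have hN : ∀ (q : RealPoly n) (w : Cn n), polyFun 0 1 ((1 - normSqPoly n) * q) w
      = (1 - ‖w‖ ^ 2) * polyFun 0 1 q w := fun q w => by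
    rw [polyFun_mul, polyFun_sub, polyFun_normSqPoly, ← C_1, polyFun_C]; simp
  set d := p.totalDegree with hd
  let W := restrictTotalDegree (Fin n ⊕ Fin n) ℝ d
  have hW : ∀ q : RealPoly n, q ∈ W ↔ q.totalDegree ≤ d := fun q => mem_restrictTotalDegree _ _ _
  have hdegN : (1 - normSqPoly n).totalDegree ≤ 2 := by
    refine (totalDegree_sub _ _).trans (max_le (by simp) ?_)
    refine totalDegree_finsetSum_le fun i _ => ?_
    exact (totalDegree_pow _ _).trans (by simp)
  let T₀ : RealPoly n →ₗ[ℝ] RealPoly n :=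
    sumSqPoly v ∘ₗ LinearMap.mulLeft ℝ (1 - normSqPoly n)
  have hT₀ : ∀ q, T₀ q = sumSqPoly v ((1 - normSqPoly n) * q) := fun q => rfl
  have hT₀W : ∀ q ∈ W, T₀ q ∈ W := fun q hq => by
    rw [hW] at hq ⊢
    rw [hT₀]
    refine (totalDegree_sumSqPoly_le v _).trans ?_
    have := totalDegree_mul (1 - normSqPoly n) q
    omega
  obtain ⟨T, hT⟩ : ∃ T : W →ₗ[ℝ] W, ∀ q : W, (T q : RealPoly n)
      = sumSqPoly v ((1 - normSqPoly n) * (q : RealPoly n)) :=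
    ⟨T₀.restrict hT₀W, fun q => by rw [LinearMap.coe_restrict_apply, hT₀]⟩
  have hinj : Function.Injective T := by
    rw [injective_iff_map_eq_zero]
    intro q hq
    have h0 : sumSqPoly v ((1 - normSqPoly n) * (q : RealPoly n)) = 0 := by
      rw [← hT, hq, Submodule.coe_zero]
    have hle : ∀ y : Cn n, ‖y‖ ≤ 1 →
        polyFun 0 1 ((1 - normSqPoly n) * (q : RealPoly n)) y ≤ 0 := fun y hy =>
      polyFun_le_of_sphere hv h0 (fun w hw => by rw [hN, hw]; simp) hy
    have h0' : sumSqPoly v (-((1 - normSqPoly n) * (q : RealPoly n))) = 0 := by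
      rw [map_neg, h0, neg_zero]
    have hnegv : ∀ (g : RealPoly n) (y : Cn n), polyFun 0 1 (-g) y = -polyFun 0 1 g y :=
      fun g y => by simp [polyFun]
    have hge : ∀ y : Cn n, ‖y‖ ≤ 1 →
        0 ≤ polyFun 0 1 ((1 - normSqPoly n) * (q : RealPoly n)) y := fun y hy => by
      have := polyFun_le_of_sphere hv h0' (M := 0) (fun w hw => by rw [hnegv, hN, hw]; simp) hy
      rw [hnegv] at this
      linarith
    refine Subtype.ext (eq_zero_of_polyFun_eq_zero fun y hy => ?_)
    have h1 := le_antisymm (hle y hy.le) (hge y hy.le)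
    rw [hN] at h1
    have h2 : (1 - ‖y‖ ^ 2) ≠ 0 := by nlinarith [norm_nonneg y]
    exact (mul_eq_zero.1 h1).resolve_left h2
  have hsurj : Function.Surjective T := LinearMap.injective_iff_surjective.1 hinj
  have hpW : sumSqPoly v p ∈ W := by
    rw [hW]
    exact (totalDegree_sumSqPoly_le v p).trans (Nat.sub_le _ _)
  obtain ⟨q, hq⟩ := hsurj ⟨_, hpW⟩
  have hq' : sumSqPoly v ((1 - normSqPoly n) * (q : RealPoly n)) = sumSqPoly v p := by
    rw [← hT, hq]
  refine ⟨p - (1 - normSqPoly n) * (q : RealPoly n), by rw [map_sub, hq', sub_self], fun w hw => ?_⟩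
  rw [polyFun_sub, hN, hw]; simp

end Comparison

/-! ### Harmonic measure of the unit sphere for a constant-coefficient operator -/

section HarmonicMeasure

open MvPolynomial

variable {n : ℕ}

/-- Restriction of polynomials to the unit sphere. -/
noncomputable def polyRestrict (n : ℕ) : RealPoly n →ₐ[ℝ] C(Metric.sphere (0 : Cn n) 1, ℝ) :=
  aeval fun i => ⟨fun w => realCoord n w.1 i,
    (continuous_apply i).comp ((realCoord n).continuous.comp continuous_subtype_val)⟩

theorem polyRestrict_apply (p : RealPoly n) (w : Metric.sphere (0 : Cn n) 1) :
    polyRestrict n p w = polyFun 0 1 p w := by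
  induction p using MvPolynomial.induction_on with
  | C r => rw [polyFun_C]; simp [polyRestrict]
  | add p q hp hq => rw [polyFun_add, ← hp, ← hq]; simp
  | mul_X p i hp =>
    rw [polyFun_mul, ← hp, polyFun_X]; simp [polyRestrict]

/-- Polynomials are dense in the continuous functions on the sphere. -/
theorem exists_polyFun_near (f : C(Metric.sphere (0 : Cn n) 1, ℝ)) {ε : ℝ} (hε : 0 < ε) :
    ∃ p : RealPoly n, ∀ w : Metric.sphere (0 : Cn n) 1, |polyFun 0 1 p w - f w| < ε := by
  have hsep : (polyRestrict n).range.SeparatesPoints := by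
    intro x y hxy
    by_contra! hcon
    refine hxy (Subtype.ext ((realCoord n).injective (funext fun i => ?_)))
    have := hcon (polyRestrict n (X i)) ⟨polyRestrict n (X i), ⟨X i, rfl⟩, rfl⟩
    rw [polyRestrict_apply, polyRestrict_apply, polyFun_X, polyFun_X] at this
    simpa using this
  obtain ⟨⟨_, p, rfl⟩, hg⟩ :=
    ContinuousMap.exists_mem_subalgebra_near_continuous_of_separatesPoints _ hsep f f.continuous
      ε hε
  refine ⟨p, fun w => ?_⟩
  have := hg w
  rwa [← polyRestrict_apply, ← Real.norm_eq_abs]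

variable {κ : Type*} [Fintype κ] {v : κ → Cn n}

/-- There is a probability measure on the unit sphere that reproduces the value at the centre of
every polynomial solution of `sumSqDeriv v h = 0`. Evaluation at the centre is a positive functional
on the solutions restricted to the sphere, and the theorems of M. Riesz and
Riesz–Markov–Kakutani apply. -/
theorem exists_harmonicMeasure (hv : ∃ k, v k ≠ 0) :
    ∃ μ : Measure (Cn n), IsProbabilityMeasure μ ∧ (∀ᵐ w ∂μ, ‖w‖ = 1) ∧
      ∀ h : RealPoly n, sumSqPoly v h = 0 → ∫ w, polyFun 0 1 h w ∂μ = polyFun 0 1 h 0 := by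
  set S := Metric.sphere (0 : Cn n) 1 with hS
  set D : Submodule ℝ (RealPoly n) := LinearMap.ker (sumSqPoly v) with hD
  set res : D →ₗ[ℝ] C(S, ℝ) := (polyRestrict n).toLinearMap ∘ₗ D.subtype with hres
  have hresv : ∀ (p : D) (w : S), res p w = polyFun 0 1 p.1 w := fun p w =>
    polyRestrict_apply p.1 w
  have hmax : ∀ p : D, (∀ w, 0 ≤ res p w) → ∀ y : Cn n, ‖y‖ ≤ 1 → 0 ≤ polyFun 0 1 p.1 y := by
    intro p hp y hy
    have h0 : sumSqPoly v (-p.1) = 0 := by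
      have : sumSqPoly v p.1 = 0 := p.2
      rw [map_neg, this, neg_zero]
    have hnegv : ∀ (g : RealPoly n) (y : Cn n), polyFun 0 1 (-g) y = -polyFun 0 1 g y :=
      fun g y => by simp [polyFun]
    have := polyFun_le_of_sphere hv h0 (M := 0) (fun w hw => by
      have := hp ⟨w, by simpa [hS] using hw⟩
      rw [hresv] at this
      rw [hnegv]; simpa using this) hy
    rw [hnegv] at this
    linarith
  have hinj : Function.Injective res := by
    rw [injective_iff_map_eq_zero]
    intro p hp
    refine Subtype.ext (eq_zero_of_polyFun_eq_zero fun y hy => le_antisymm ?_ ?_)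
    · have := hmax (-p) (fun w => by rw [map_neg, hp]; simp) y hy.le
      have e : polyFun 0 1 (-p : D).1 y = -polyFun 0 1 p.1 y := by simp [polyFun]
      rw [e] at this
      linarith
    · exact hmax p (fun w => by rw [hp]; simp) y hy.le
  set eqv := LinearEquiv.ofInjective res hinj with heqv
  set ev0 : D →ₗ[ℝ] ℝ :=
    (aeval (realCoord n 0) : RealPoly n →ₐ[ℝ] ℝ).toLinearMap ∘ₗ D.subtype with hev0
  have hev0v : ∀ p : D, ev0 p = polyFun 0 1 p.1 0 := fun p => by
    simp only [hev0, polyFun, LinearMap.comp_apply, Submodule.subtype_apply,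
      AlgHom.toLinearMap_apply, sub_zero, smul_zero]
    rw [aeval_eq_eval]
  set f : C(S, ℝ) →ₗ.[ℝ] ℝ := ⟨LinearMap.range res, ev0 ∘ₗ eqv.symm.toLinearMap⟩ with hf
  have hfv : ∀ p : D, f ⟨res p, p, rfl⟩ = polyFun 0 1 p.1 0 := fun p => by
    have : eqv.symm ⟨res p, p, rfl⟩ = p := by
      rw [LinearEquiv.symm_apply_eq]; rfl
    change ev0 (eqv.symm ⟨res p, p, rfl⟩) = _
    rw [this, hev0v]
  have hconst : ∀ c : ℝ, ∃ p : D, ∀ w, res p w = c := fun c => by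
    refine ⟨⟨C c, ?_⟩, fun w => ?_⟩
    · rw [hD, LinearMap.mem_ker, sumSqPoly_apply]; simp
    · rw [hresv, polyFun_C]
  obtain ⟨g, hgf, hgpos⟩ := riesz_extension (PointedCone.positive ℝ C(S, ℝ)) f
    (by
      rintro ⟨_, p, rfl⟩ hx
      rw [hfv]
      exact hmax p (fun w => hx w) 0 (by simp))
    (by
      intro y
      obtain ⟨p, hp⟩ := hconst ‖y‖
      refine ⟨⟨res p, p, rfl⟩, ?_⟩
      change (0 : C(S, ℝ)) ≤ _
      intro w
      have := (abs_le.1 (y.norm_coe_le_norm w)).1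
      change 0 ≤ res p w + y w
      rw [hp]
      linarith)
  have hgmono : ∀ f₁ f₂ : C(S, ℝ), f₁ ≤ f₂ → g f₁ ≤ g f₂ := fun f₁ f₂ h => by
    have := hgpos (f₂ - f₁) (sub_nonneg.2 h)
    rw [map_sub] at this
    linarith
  let Λ : CompactlySupportedContinuousMap S ℝ →ₚ[ℝ] ℝ :=
    { toFun := fun u => g u.toContinuousMap
      map_add' := fun u w => by rw [← map_add]; rfl
      map_smul' := fun c u => by rw [RingHom.id_apply, ← map_smul]; rfl
      monotone' := fun u w h => hgmono _ _ h }
  have hint : ∀ u : C(S, ℝ), ∫ w, u w ∂(RealRMK.rieszMeasure Λ) = g u := fun u =>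
    RealRMK.integral_rieszMeasure Λ ⟨u, HasCompactSupport.of_compactSpace _⟩
  have hintp : ∀ h : RealPoly n, sumSqPoly v h = 0 →
      ∫ w : S, polyFun 0 1 h w ∂(RealRMK.rieszMeasure Λ) = polyFun 0 1 h 0 := fun h hh => by
    have h1 := hint (res ⟨h, hh⟩)
    rw [hgf ⟨res ⟨h, hh⟩, _, rfl⟩, hfv] at h1
    rw [← h1]
    exact integral_congr_ae (Filter.Eventually.of_forall fun w => (hresv ⟨h, hh⟩ w).symm)
  refine ⟨(RealRMK.rieszMeasure Λ).map Subtype.val, ?_, ?_, fun h hh => ?_⟩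
  · have h1 := hintp (C 1) (by rw [sumSqPoly_apply]; simp)
    simp only [polyFun_C, integral_const, smul_eq_mul, mul_one] at h1
    have : IsProbabilityMeasure (RealRMK.rieszMeasure Λ) := by
      refine ⟨?_⟩
      rw [measureReal_def, ENNReal.toReal_eq_one_iff] at h1
      exact h1
    exact Measure.isProbabilityMeasure_map measurable_subtype_coe.aemeasurable
  · rw [ae_map_iff measurable_subtype_coe.aemeasurable
      (measurableSet_eq_fun measurable_norm measurable_const)]
    exact Filter.Eventually.of_forall fun w => by simp
  · rw [integral_map measurable_subtype_coe.aemeasurable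
      (contDiff_polyFun 0 1 h (N := 0)).continuous.aestronglyMeasurable]
    exact hintp h hh

/-- A probability measure on the unit sphere with the mean value property for the solutions of
`sumSqDeriv v h = 0`. -/
structure IsHarmonicMeasure (v : κ → Cn n) (μ : Measure (Cn n)) : Prop where
  isProb : IsProbabilityMeasure μ
  norm_eq_one : ∀ᵐ w ∂μ, ‖w‖ = 1
  integral_eq : ∀ h : RealPoly n, sumSqPoly v h = 0 →
    ∫ w, polyFun 0 1 h w ∂μ = polyFun 0 1 h 0

theorem IsHarmonicMeasure.integrable {μ : Measure (Cn n)} (hμ : IsHarmonicMeasure v μ)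
    {f : Cn n → ℝ} (hf : Continuous f) : Integrable f μ := by
  have := hμ.isProb
  obtain ⟨M, hM⟩ := (isCompact_sphere (0 : Cn n) 1).exists_bound_of_continuousOn hf.continuousOn
  refine Integrable.of_bound hf.aestronglyMeasurable M ?_
  filter_upwards [hμ.norm_eq_one] with w hw
  exact hM w (by simpa using hw)

/-- Mean value inequality for viscosity subsolutions of `sumSqDeriv v φ ≥ b`. -/
theorem IsHarmonicMeasure.le_integral {μ : Measure (Cn n)} (hμ : IsHarmonicMeasure v μ)
    (hv : ∃ k, v k ≠ 0) {φ : Cn n → EReal} {a : Cn n} {r : ℝ} (hr : 0 < r)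
    (husc : UpperSemicontinuousOn φ (Metric.closedBall a r))
    (hlt : ∀ z ∈ Metric.closedBall a r, φ z < ⊤) {b : ℝ}
    (htest : ∀ x ∈ Metric.ball a r, ∀ V ⊆ Metric.ball a r, ∀ q, IsUpperTest φ x V q →
      b ≤ sumSqDeriv v q x)
    {f : Cn n → ℝ} (hf : Continuous f) (hle : ∀ w, ‖w‖ = 1 → φ (a + r • w) ≤ (f w : EReal)) :
    φ a ≤ ((∫ w, f w ∂μ - b * r ^ 2 / (2 * ∑ k, ‖v k‖ ^ 2) : ℝ) : EReal) := by
  have := hμ.isProb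
  set ℓ := 2 * ∑ k, ‖v k‖ ^ 2 with hℓ
  have hℓpos : 0 < ℓ := sum_norm_sq_pos hv
  refine EReal.le_of_forall_lt_iff_le.1 fun t ht => ?_
  have ht' : ∫ w, f w ∂μ - b * r ^ 2 / ℓ < t := by exact_mod_cast ht
  set ε := (t - (∫ w, f w ∂μ - b * r ^ 2 / ℓ)) / 2 with hε
  have hεpos : 0 < ε := by rw [hε]; linarith
  obtain ⟨p₀, hp₀⟩ := exists_polyFun_near ⟨fun w => f w.1, hf.comp continuous_subtype_val⟩ hεpos
  -- a polynomial between `f` and `f + 2ε` on the sphere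
  set p := p₀ + C ε with hp
  have hpv : ∀ w, polyFun 0 1 p w = polyFun 0 1 p₀ w + ε := fun w => by
    rw [hp, polyFun_add, polyFun_C]
  have hpf : ∀ w : Cn n, ‖w‖ = 1 → f w ≤ polyFun 0 1 p w ∧ polyFun 0 1 p w ≤ f w + 2 * ε := by
    intro w hw
    have := abs_lt.1 (hp₀ ⟨w, by simpa using hw⟩)
    simp only [ContinuousMap.coe_mk] at this
    rw [hpv]
    constructor <;> linarith [this.1, this.2]
  obtain ⟨h, hh0, hhp⟩ := exists_sumSqPoly_eq_zero_of_sphere hv p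
  -- the multiple of `|z|² - 1` vanishes on the sphere and accounts for the right-hand side `b`
  set H := h + C (b * r ^ 2 / ℓ) * (normSqPoly n - 1) with hHdef
  have hH : sumSqPoly v H = C (b * r ^ 2) := by
    have h10 : sumSqPoly v 1 = 0 := by rw [sumSqPoly_apply]; simp
    rw [hHdef, ← smul_eq_C_mul, map_add, map_smul, map_sub, h10, hh0, sumSqPoly_normSqPoly,
      smul_eq_C_mul, sub_zero, zero_add, ← C_mul, div_mul_cancel₀ _ hℓpos.ne']
  have hHv : ∀ y, polyFun a r⁻¹ H y
      = polyFun 0 1 h (r⁻¹ • (y - a)) + b * r ^ 2 / ℓ * (‖r⁻¹ • (y - a)‖ ^ 2 - 1) := fun y => by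
    rw [hHdef, polyFun_add, polyFun_mul, polyFun_C, polyFun_sub, polyFun_normSqPoly, ← C_1,
      polyFun_C]
    simp [polyFun]
  have hcomp := le_polyFun_of_viscosity hv hr husc hlt htest hH (fun y hy => by
    have hw : ‖r⁻¹ • (y - a)‖ = 1 := by
      rw [norm_smul, Real.norm_of_nonneg (inv_pos.2 hr).le, ← dist_eq_norm, hy,
        inv_mul_cancel₀ hr.ne']
    have h1 := hle _ hw
    rw [smul_inv_smul₀ hr.ne', add_sub_cancel] at h1
    refine h1.trans ?_
    have : f (r⁻¹ • (y - a)) ≤ polyFun a r⁻¹ H y := by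
      rw [hHv, hw, hhp _ hw]
      linarith [(hpf _ hw).1]
    exact_mod_cast this) a (Metric.mem_closedBall_self hr.le)
  refine hcomp.trans ?_
  rw [hHv, sub_self, smul_zero, ← hμ.integral_eq h hh0]
  have hcont : ∀ q : RealPoly n, Continuous (polyFun 0 1 q) := fun q =>
    (contDiff_polyFun 0 1 q (N := 0)).continuous
  have h2 : ∫ w, polyFun 0 1 h w ∂μ ≤ ∫ w, (f w + 2 * ε) ∂μ := by
    refine integral_mono_ae (hμ.integrable (hcont h))
      (hμ.integrable (hf.add continuous_const)) ?_
    filter_upwards [hμ.norm_eq_one] with w hw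
    rw [hhp w hw]
    exact (hpf w hw).2
  rw [integral_add (hμ.integrable hf) (integrable_const _)] at h2
  simp only [integral_const, probReal_univ, smul_eq_mul, one_mul] at h2
  have h3 : ∫ w, polyFun 0 1 h w ∂μ + b * r ^ 2 / ℓ * (‖(0 : Cn n)‖ ^ 2 - 1) ≤ t := by
    rw [norm_zero]
    linarith
  exact_mod_cast h3

end HarmonicMeasure

/-! ### The operator `P` as a supremum of affine functions -/

section OperatorP

open Matrix

variable {m : ℕ}

/-- Simultaneous diagonalization of a positive definite and a Hermitian form. -/
theorem exists_simultaneous_diagonalization {n : ℕ} {B A : Matrix (Fin n) (Fin n) ℂ}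
    (hB : B.PosDef) (hA : A.IsHermitian) :
    ∃ (G : Matrix (Fin n) (Fin n) ℂ) (l : Fin n → ℝ), IsUnit G.det ∧ B = G * Gᴴ ∧
      A = G * diagonal (fun i => (l i : ℂ)) * Gᴴ ∧
      relEigenvalues B A = Finset.univ.val.map l := by
  obtain ⟨K, hK⟩ : ∃ K : Matrix (Fin n) (Fin n) ℂ, B = Kᴴ * K := by
    open scoped MatrixOrder in
    obtain ⟨K, hK⟩ := CStarAlgebra.nonneg_iff_eq_star_mul_self.1 hB.posSemidef.nonneg
    exact ⟨K, hK⟩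
  have hKdet : IsUnit Kᴴ.det := by
    have h1 := hB.isUnit
    rw [isUnit_iff_isUnit_det, hK, det_mul, IsUnit.mul_iff] at h1
    exact h1.1
  set J := (Kᴴ)⁻¹ with hJ
  have hJK : Kᴴ * J = 1 := mul_nonsing_inv _ hKdet
  have hKJ : Jᴴ * K = 1 := by
    have := congrArg conjTranspose hJK
    simpa using this
  have hM : (J * A * Jᴴ).IsHermitian := isHermitian_mul_mul_conjTranspose J hA
  set U : Matrix (Fin n) (Fin n) ℂ := ↑hM.eigenvectorUnitary with hU
  have hUU : U * Uᴴ = 1 := by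
    have := Unitary.coe_mul_star_self hM.eigenvectorUnitary
    exact this
  have hUdet : IsUnit U.det := by
    refine IsUnit.of_mul_eq_one Uᴴ.det ?_
    rw [← det_mul, hUU, det_one]
  set l := hM.eigenvalues with hl
  have hspec : J * A * Jᴴ = U * diagonal (fun i => (l i : ℂ)) * Uᴴ := hM.spectral_theorem
  have hAeq : A = (Kᴴ * U) * diagonal (fun i => (l i : ℂ)) * (Kᴴ * U)ᴴ := by
    calc A = (Kᴴ * J) * A * (Jᴴ * K) := by rw [hJK, hKJ, Matrix.one_mul, Matrix.mul_one]
      _ = Kᴴ * (J * A * Jᴴ) * K := by simp only [Matrix.mul_assoc]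
      _ = _ := by
        rw [hspec, conjTranspose_mul, conjTranspose_conjTranspose]
        simp only [Matrix.mul_assoc]
  have hBeq : B = (Kᴴ * U) * (Kᴴ * U)ᴴ := by
    rw [conjTranspose_mul, conjTranspose_conjTranspose, Matrix.mul_assoc, ← Matrix.mul_assoc U,
      hUU, Matrix.one_mul, hK]
  have hGdet : IsUnit (Kᴴ * U).det := by rw [det_mul]; exact hKdet.mul hUdet
  refine ⟨Kᴴ * U, l, hGdet, hBeq, hAeq, ?_⟩
  set G := Kᴴ * U
  have hGH : IsUnit Gᴴ.det := by rw [det_conjTranspose]; exact hGdet.star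
  have hchar : (B⁻¹ * A).charpoly = (diagonal fun i => (l i : ℂ)).charpoly := by
    have h1 : B⁻¹ * A = (Gᴴ)⁻¹ * (diagonal (fun i => (l i : ℂ)) * Gᴴ) := by
      rw [hBeq, hAeq, Matrix.mul_inv_rev, Matrix.mul_assoc, Matrix.mul_assoc,
        nonsing_inv_mul_cancel_left _ _ hGdet]
    rw [h1, charpoly_mul_comm, Matrix.mul_assoc, mul_nonsing_inv _ hGH, Matrix.mul_one]
  rw [relEigenvalues, hchar, charpoly_diagonal, Polynomial.roots_prod _ _
    (Finset.prod_ne_zero_iff.2 fun i _ => Polynomial.X_sub_C_ne_zero _)]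
  simp [Function.comp_def]

theorem opP_le_iff_of_relEigenvalues {B A : Matrix (Fin (m + 1)) (Fin (m + 1)) ℂ}
    {l : Fin (m + 1) → ℝ} (h : relEigenvalues B A = Finset.univ.val.map l) (c : ℝ) :
    (opP B A : EReal) ≤ (c : EReal) ↔
      0 ≤ c ∧ ∀ k : Fin (m + 1),
        ∑ j : Fin m, (ENNReal.ofReal (l (k.succAbove j)))⁻¹ ≤ ENNReal.ofReal c := by
  have h1 : ∀ C : ENNReal, opP B A ≤ C ↔
      ∀ k : Fin (m + 1), ∑ j : Fin m, (ENNReal.ofReal (l (k.succAbove j)))⁻¹ ≤ C := fun C => by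
    rw [opP, h, Multiset.sup_le]
    simp only [Multiset.mem_map, Finset.mem_val, Finset.mem_univ, true_and, forall_exists_index,
      exists_exists_eq_and, forall_apply_eq_imp_iff]
    refine forall_congr' fun k => ?_
    have h2 : (Finset.univ.val.map l).erase (l k) = (Finset.univ.erase k).val.map l := by
      rw [Finset.erase_val, Multiset.map_erase_of_mem _ _ (Finset.mem_univ_val k)]
    have h3 : Finset.univ.erase k = Finset.univ.map (Fin.succAboveEmb k) := by
      ext i
      simp only [Finset.mem_erase, Finset.mem_univ, and_true, Finset.mem_map, true_and,
        Fin.succAboveEmb_apply, Fin.exists_succAbove_eq_iff]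
    have h4 : (((Finset.univ.erase k).val.map l).map fun m => (ENNReal.ofReal m)⁻¹).sum
        = ∑ i ∈ Finset.univ.erase k, (ENNReal.ofReal (l i))⁻¹ := by
      rw [Multiset.map_map]; rfl
    rw [h2, h4, h3, Finset.sum_map]
    rfl
  constructor
  · intro hle
    have hc : 0 ≤ c := by
      have := (EReal.coe_ennreal_nonneg (opP B A)).trans hle
      exact_mod_cast this
    refine ⟨hc, (h1 _).1 ?_⟩
    rw [← EReal.coe_ennreal_le_coe_ennreal_iff, EReal.coe_ennreal_ofReal, max_eq_left hc]
    exact hle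
  · rintro ⟨hc, hle⟩
    have := (h1 _).2 hle
    rwa [← EReal.coe_ennreal_le_coe_ennreal_iff, EReal.coe_ennreal_ofReal, max_eq_left hc] at this

theorem re_trace_conjTranspose_mul {n p : ℕ} (Y S : Matrix (Fin n) (Fin p) ℂ) :
    (Yᴴ * S).trace.re = ∑ j, ∑ i, (conj (Y i j) * S i j).re := by
  simp [trace, Matrix.mul_apply, Complex.re_sum]

theorem re_trace_conjTranspose_mul_diagonal_mul {n p : ℕ} (Y : Matrix (Fin n) (Fin p) ℂ)
    (l : Fin n → ℝ) :
    (Yᴴ * diagonal (fun i => (l i : ℂ)) * Y).trace.re = ∑ j, ∑ i, l i * ‖Y i j‖ ^ 2 := by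
  rw [Matrix.mul_assoc, re_trace_conjTranspose_mul]
  refine Finset.sum_congr rfl fun j _ => Finset.sum_congr rfl fun i _ => ?_
  rw [diagonal_mul, ← Complex.normSq_eq_norm_sq, Complex.normSq_apply]
  simp
  ring

theorem posSemidef_one_sub_mul_conjTranspose_iff {n p : ℕ} (S : Matrix (Fin n) (Fin p) ℂ) :
    (1 - S * Sᴴ).PosSemidef ↔ (1 - Sᴴ * S).PosSemidef := by
  let _ : Invertible (1 : Matrix (Fin n) (Fin n) ℂ) := invertibleOne
  let _ : Invertible (1 : Matrix (Fin p) (Fin p) ℂ) := invertibleOne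
  have h1 := PosDef.fromBlocks₁₁ (A := (1 : Matrix (Fin n) (Fin n) ℂ)) S
    (1 : Matrix (Fin p) (Fin p) ℂ) PosDef.one
  have h2 := PosDef.fromBlocks₂₂ (1 : Matrix (Fin n) (Fin n) ℂ) S
    (D := (1 : Matrix (Fin p) (Fin p) ℂ)) PosDef.one
  rw [inv_one, Matrix.mul_one] at h1 h2
  exact h2.symm.trans h1

theorem sum_norm_sq_le_one_of_posSemidef {n p : ℕ} {S : Matrix (Fin n) (Fin p) ℂ}
    (h : (1 - S * Sᴴ).PosSemidef) (i : Fin n) : ∑ j, ‖S i j‖ ^ 2 ≤ 1 := by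
  have h1 := (Complex.le_def.1 (h.diag_nonneg (i := i))).1
  simp only [Matrix.sub_apply, one_apply_eq, Matrix.mul_apply, conjTranspose_apply, Complex.zero_re,
    Complex.sub_re, Complex.one_re, Complex.re_sum] at h1
  have h2 : ∀ j, (S i j * star (S i j)).re = ‖S i j‖ ^ 2 := fun j => by
    rw [← Complex.normSq_eq_norm_sq, Complex.normSq_apply]; simp
  simp only [h2] at h1
  linarith

/-- The diagonal case: the linear programme `∑ a i / l i`, `0 ≤ a i ≤ 1`, `∑ a i ≤ m` attains its
maximum when `a` is the indicator of the complement of one index. -/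
theorem forall_sum_succAbove_le_iff (l : Fin (m + 1) → ℝ) (c : ℝ) :
    (0 ≤ c ∧ ∀ k : Fin (m + 1),
        ∑ j : Fin m, (ENNReal.ofReal (l (k.succAbove j)))⁻¹ ≤ ENNReal.ofReal c) ↔
      ∀ S Y : Matrix (Fin (m + 1)) (Fin m) ℂ, (1 - S * Sᴴ).PosSemidef →
        2 * (Yᴴ * S).trace.re ≤ c + (Yᴴ * diagonal (fun i => (l i : ℂ)) * Y).trace.re := by
  constructor
  · rintro ⟨hc, hk⟩ S Y hS
    rcases Nat.eq_zero_or_pos m with rfl | hm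
    · simpa [trace] using hc
    have hlpos : ∀ i, 0 < l i := fun i => by
      have : Nontrivial (Fin (m + 1)) := Fin.nontrivial_iff_two_le.2 (by omega)
      obtain ⟨k, hki⟩ := exists_ne i
      obtain ⟨j, rfl⟩ := Fin.exists_succAbove_eq hki.symm
      have h1 := (Finset.single_le_sum (f := fun j => (ENNReal.ofReal (l (k.succAbove j)))⁻¹)
        (fun _ _ => zero_le) (Finset.mem_univ j)).trans (hk k)
      by_contra! hneg
      simp only [ENNReal.ofReal_of_nonpos hneg, ENNReal.inv_zero, top_le_iff] at h1
      exact ENNReal.ofReal_ne_top h1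
    have hreal : ∀ k : Fin (m + 1), ∑ j : Fin m, (l (k.succAbove j))⁻¹ ≤ c := fun k => by
      have h1 := hk k
      rw [Finset.sum_congr rfl fun j _ => (ENNReal.ofReal_inv_of_pos (hlpos (k.succAbove j))).symm,
        ← ENNReal.ofReal_sum_of_nonneg fun j _ => (inv_pos.2 (hlpos _)).le] at h1
      exact (ENNReal.ofReal_le_ofReal_iff hc).1 h1
    set a : Fin (m + 1) → ℝ := fun i => ∑ j, ‖S i j‖ ^ 2 with ha
    have ha1 : ∀ i, a i ≤ 1 := sum_norm_sq_le_one_of_posSemidef hS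
    have hasum : ∑ i, a i ≤ m := by
      rw [ha, Finset.sum_comm]
      have h2 := (posSemidef_one_sub_mul_conjTranspose_iff S).1 hS
      have h3 : (1 - Sᴴ * Sᴴᴴ).PosSemidef := by rwa [conjTranspose_conjTranspose]
      calc ∑ j, ∑ i, ‖S i j‖ ^ 2 ≤ ∑ j : Fin m, (1 : ℝ) := by
            refine Finset.sum_le_sum fun j _ => ?_
            simpa using sum_norm_sq_le_one_of_posSemidef h3 j
        _ = m := by simp
    -- drop the index `k` with the largest eigenvalue
    obtain ⟨k, -, hkmax⟩ := Finset.exists_max_image Finset.univ l ⟨0, Finset.mem_univ _⟩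
    have hbound : ∑ i, a i * (l i)⁻¹ ≤ c := by
      refine le_trans ?_ (hreal k)
      rw [Fin.sum_univ_succAbove _ k] at hasum ⊢
      have h4 : ∀ j : Fin m, a (k.succAbove j) * (l (k.succAbove j))⁻¹
          ≤ (l (k.succAbove j))⁻¹ - (1 - a (k.succAbove j)) * (l k)⁻¹ := fun j => by
        have h5 : (l k)⁻¹ ≤ (l (k.succAbove j))⁻¹ :=
          inv_anti₀ (hlpos _) (hkmax _ (Finset.mem_univ _))
        nlinarith [ha1 (k.succAbove j)]
      have h6 := Finset.sum_le_sum fun j (_ : j ∈ Finset.univ) => h4 j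
      rw [Finset.sum_sub_distrib, ← Finset.sum_mul, Finset.sum_sub_distrib] at h6
      simp only [Finset.sum_const, Finset.card_univ, Fintype.card_fin, nsmul_eq_mul,
        mul_one] at h6
      have h7 : 0 < (l k)⁻¹ := inv_pos.2 (hlpos k)
      nlinarith
    rw [re_trace_conjTranspose_mul, re_trace_conjTranspose_mul_diagonal_mul]
    have hterm : ∀ i j, 2 * (conj (Y i j) * S i j).re
        ≤ l i * ‖Y i j‖ ^ 2 + ‖S i j‖ ^ 2 * (l i)⁻¹ := fun i j => by
      have h1 : (conj (Y i j) * S i j).re ≤ ‖Y i j‖ * ‖S i j‖ := by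
        refine (Complex.re_le_norm _).trans ?_
        rw [norm_mul, Complex.norm_conj]
      have hl := hlpos i
      have h2 : 0 ≤ (l i)⁻¹ * (l i * ‖Y i j‖ - ‖S i j‖) ^ 2 := by positivity
      have h3 : (l i)⁻¹ * (l i * ‖Y i j‖ - ‖S i j‖) ^ 2
          = l i * ‖Y i j‖ ^ 2 - 2 * (‖Y i j‖ * ‖S i j‖) + ‖S i j‖ ^ 2 * (l i)⁻¹ := by
        field_simp
        ring
      linarith
    have hsum : ∑ j, ∑ i, ‖S i j‖ ^ 2 * (l i)⁻¹ = ∑ i, a i * (l i)⁻¹ := by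
      rw [Finset.sum_comm]
      simp only [ha, Finset.sum_mul]
    calc 2 * ∑ j, ∑ i, (conj (Y i j) * S i j).re
        = ∑ j, ∑ i, 2 * (conj (Y i j) * S i j).re := by simp only [Finset.mul_sum]
      _ ≤ ∑ j, ∑ i, (l i * ‖Y i j‖ ^ 2 + ‖S i j‖ ^ 2 * (l i)⁻¹) :=
          Finset.sum_le_sum fun j _ => Finset.sum_le_sum fun i _ => hterm i j
      _ = ∑ j, ∑ i, l i * ‖Y i j‖ ^ 2 + ∑ i, a i * (l i)⁻¹ := by
          simp only [Finset.sum_add_distrib, hsum]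
      _ ≤ _ := by linarith
  · intro h
    have hc : 0 ≤ c := by
      have := h 0 0 (by simpa using PosSemidef.one)
      simpa using this
    refine ⟨hc, fun k => ?_⟩
    -- test with the coordinate vectors other than the `k`-th, and multiples of them
    have hmain : ∀ y : Fin m → ℝ, ∑ j, (2 * y j - l (k.succAbove j) * y j ^ 2) ≤ c := fun y => by
      set S : Matrix (Fin (m + 1)) (Fin m) ℂ :=
        of fun i j => if i = k.succAbove j then 1 else 0 with hS
      set Y : Matrix (Fin (m + 1)) (Fin m) ℂ :=
        of fun i j => if i = k.succAbove j then (y j : ℂ) else 0 with hY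
      have hSS : Sᴴ * S = 1 := by
        ext i j
        simp [hS, Matrix.mul_apply, Matrix.one_apply, eq_comm]
      have h1 := h S Y ((posSemidef_one_sub_mul_conjTranspose_iff S).2 (by
        rw [hSS, sub_self]; exact PosSemidef.zero))
      rw [re_trace_conjTranspose_mul, re_trace_conjTranspose_mul_diagonal_mul] at h1
      have h2 : ∀ j, ∑ i, (conj (Y i j) * S i j).re = y j := fun j => by
        rw [Finset.sum_eq_single (k.succAbove j)]
        · simp [hY, hS]
        · intro i _ hi; simp [hS, hi]
        · simp
      have h3 : ∀ j, ∑ i, l i * ‖Y i j‖ ^ 2 = l (k.succAbove j) * y j ^ 2 := fun j => by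
        rw [Finset.sum_eq_single (k.succAbove j)]
        · simp [hY]
        · intro i _ hi; simp [hY, hi]
        · simp
      simp only [h2, h3] at h1
      rw [Finset.sum_sub_distrib, ← Finset.mul_sum]
      linarith
    by_cases hpos : ∀ j, 0 < l (k.succAbove j)
    · rw [Finset.sum_congr rfl fun j _ => (ENNReal.ofReal_inv_of_pos (hpos j)).symm,
        ← ENNReal.ofReal_sum_of_nonneg fun j _ => (inv_pos.2 (hpos _)).le]
      refine ENNReal.ofReal_le_ofReal ?_
      refine le_trans (Finset.sum_le_sum fun j _ => ?_)
        (hmain fun j => (l (k.succAbove j))⁻¹)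
      have := (hpos j).ne'
      refine le_of_eq ?_
      field_simp
      ring
    -- an eigenvalue `≤ 0` makes the left-hand side exceed `c` for a multiple `c + 1`
    · exfalso
      push Not at hpos
      obtain ⟨j₀, hj₀⟩ := hpos
      have h1 := hmain (Pi.single j₀ (c + 1))
      rw [Finset.sum_eq_single j₀] at h1
      · simp only [Pi.single_eq_same] at h1
        nlinarith [sq_nonneg (c + 1)]
      · intro j _ hj; simp [Pi.single_eq_of_ne hj]
      · simp

/-- The condition `P_B(A) ≤ c` amounts to a family of affine inequalities in `A`, indexed by the
`n × (n - 1)` matrices `S` with `S Sᴴ ≤ B` and by arbitrary `n × (n - 1)` matrices `Y`. It comes from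
`s* A⁻¹ s = sup_y (2 Re y* s - y* A y)` and from `P_B(A) = sup_S tr (Sᴴ A⁻¹ S)`. -/
theorem opP_le_iff {B A : Matrix (Fin (m + 1)) (Fin (m + 1)) ℂ} (hB : B.PosDef)
    (hA : A.IsHermitian) (c : ℝ) :
    (opP B A : EReal) ≤ (c : EReal) ↔
      ∀ S Y : Matrix (Fin (m + 1)) (Fin m) ℂ, (B - S * Sᴴ).PosSemidef →
        2 * (Yᴴ * S).trace.re ≤ c + (Yᴴ * A * Y).trace.re := by
  obtain ⟨G, l, hG, hBG, hAG, hl⟩ := exists_simultaneous_diagonalization hB hA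
  rw [opP_le_iff_of_relEigenvalues hl, forall_sum_succAbove_le_iff]
  have hGi : G * G⁻¹ = 1 := mul_nonsing_inv _ hG
  have hGi' : G⁻¹ * G = 1 := nonsing_inv_mul _ hG
  have hGH : Gᴴ * (G⁻¹)ᴴ = 1 := by rw [← conjTranspose_mul, hGi', conjTranspose_one]
  have hGH' : (G⁻¹)ᴴ * Gᴴ = 1 := by rw [← conjTranspose_mul, hGi, conjTranspose_one]
  have key : ∀ S Y : Matrix (Fin (m + 1)) (Fin m) ℂ,
      Yᴴ * (G * S) = (Gᴴ * Y)ᴴ * S ∧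
      Yᴴ * A * Y = (Gᴴ * Y)ᴴ * diagonal (fun i => (l i : ℂ)) * (Gᴴ * Y) := fun S Y => by
    constructor
    · simp only [conjTranspose_mul, conjTranspose_conjTranspose, Matrix.mul_assoc]
    · rw [hAG]
      simp only [conjTranspose_mul, conjTranspose_conjTranspose, Matrix.mul_assoc]
  have hsub : ∀ S : Matrix (Fin (m + 1)) (Fin m) ℂ,
      B - (G * S) * (G * S)ᴴ = G * (1 - S * Sᴴ) * Gᴴ := fun S => by
    rw [hBG]
    simp only [conjTranspose_mul, Matrix.mul_sub, Matrix.sub_mul, Matrix.mul_one,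
      Matrix.mul_assoc]
  constructor
  · intro h S Y hS
    have hS1 : S = G * (G⁻¹ * S) := by rw [← Matrix.mul_assoc, hGi, Matrix.one_mul]
    have hPS : (1 - (G⁻¹ * S) * (G⁻¹ * S)ᴴ).PosSemidef := by
      rw [hS1, hsub] at hS
      have := hS.mul_mul_conjTranspose_same G⁻¹
      have e : G⁻¹ * (G * (1 - G⁻¹ * S * (G⁻¹ * S)ᴴ) * Gᴴ) * (G⁻¹)ᴴ
          = (G⁻¹ * G) * (1 - G⁻¹ * S * (G⁻¹ * S)ᴴ) * (Gᴴ * (G⁻¹)ᴴ) := by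
        simp only [Matrix.mul_assoc]
      rwa [e, hGi', hGH, Matrix.one_mul, Matrix.mul_one] at this
    have h1 := h (G⁻¹ * S) (Gᴴ * Y) hPS
    rw [← (key (G⁻¹ * S) Y).1, ← (key (G⁻¹ * S) Y).2, ← hS1] at h1
    exact h1
  · intro h S Y hS
    have hY1 : Y = Gᴴ * ((G⁻¹)ᴴ * Y) := by rw [← Matrix.mul_assoc, hGH, Matrix.one_mul]
    have h1 := h (G * S) ((G⁻¹)ᴴ * Y) (by
      rw [hsub]; exact hS.mul_mul_conjTranspose_same G)
    rw [(key S _).1, (key S _).2, ← hY1] at h1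
    exact h1

end OperatorP

/-! ### The complex Hessian and real second derivatives -/

section ComplexHessian

open Matrix

variable {n : ℕ}

theorem complexHessian_apply {f : Cn n → ℝ} {z : Cn n} (hf : ContDiffAt ℝ 2 f z) (j k : Fin n) :
    complexHessian f z j k = (1 / 4 : ℂ) *
      (((fderiv ℝ (fderiv ℝ f) z (stdVec n j) (stdVec n k)
        + fderiv ℝ (fderiv ℝ f) z (Complex.I • stdVec n j) (Complex.I • stdVec n k) : ℝ) : ℂ)
      + Complex.I * ((fderiv ℝ (fderiv ℝ f) z (stdVec n j) (Complex.I • stdVec n k)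
        - fderiv ℝ (fderiv ℝ f) z (Complex.I • stdVec n j) (stdVec n k) : ℝ) : ℂ)) := by
  have hd := hf.differentiableAt_fderiv_of_two
  have hof : ∀ (g : Cn n → ℝ) (y : Cn n), DifferentiableAt ℝ g y → ∀ u,
      fderiv ℝ (fun y => (g y : ℂ)) y u = ((fderiv ℝ g y u : ℝ) : ℂ) := fun g y hg u => by
    have h1 : HasFDerivAt (fun y => (g y : ℂ)) (Complex.ofRealCLM ∘L fderiv ℝ g y) y :=
      Complex.ofRealCLM.hasFDerivAt.comp y hg.hasFDerivAt
    rw [h1.fderiv]; rfl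
  have hev : wirtingerBar k (fun y => (f y : ℂ)) =ᶠ[nhds z] fun y =>
      (1 / 2 : ℂ) * ((fderiv ℝ f y (stdVec n k) : ℝ)
        + Complex.I * ((fderiv ℝ f y (Complex.I • stdVec n k) : ℝ) : ℂ)) := by
    filter_upwards [hf.eventually_differentiableAt_of_two] with y hy
    rw [wirtingerBar, hof f y hy, hof f y hy]
  have hdir : ∀ w : Cn n, HasFDerivAt (fun y => ((fderiv ℝ f y w : ℝ) : ℂ))
      (Complex.ofRealCLM ∘L ((fderiv ℝ (fderiv ℝ f) z).flip w)) z := fun w => by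
    have h1 : HasFDerivAt (fun y => fderiv ℝ f y w) ((fderiv ℝ (fderiv ℝ f) z).flip w) z := by
      have := hd.hasFDerivAt.clm_apply (hasFDerivAt_const w z)
      refine this.congr_fderiv ?_
      ext u; simp
    exact Complex.ofRealCLM.hasFDerivAt.comp z h1
  have hD := (((hdir (stdVec n k)).add
    ((hdir (Complex.I • stdVec n k)).const_mul Complex.I)).const_mul (1 / 2 : ℂ))
  have hval : ∀ u, fderiv ℝ (wirtingerBar k (fun y => (f y : ℂ))) z u = (1 / 2 : ℂ) *
      ((fderiv ℝ (fderiv ℝ f) z u (stdVec n k) : ℝ)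
        + Complex.I * ((fderiv ℝ (fderiv ℝ f) z u (Complex.I • stdVec n k) : ℝ) : ℂ)) := fun u => by
    have e : fderiv ℝ (wirtingerBar k (fun y => (f y : ℂ))) z = _ :=
      hev.fderiv_eq.trans hD.fderiv
    rw [e]
    simp [mul_add]
  rw [complexHessian, of_apply, wirtinger, hval, hval]
  push_cast
  linear_combination (1 / 4 : ℂ) * (fderiv ℝ (fderiv ℝ f) z (Complex.I • stdVec n j)
    (Complex.I • stdVec n k) : ℂ) * (-Complex.I_sq)

theorem isHermitian_complexHessian {f : Cn n → ℝ} {z : Cn n} (hf : ContDiffAt ℝ 2 f z) :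
    (complexHessian f z).IsHermitian := by
  ext j k
  rw [conjTranspose_apply, complexHessian_apply hf, complexHessian_apply hf,
    hf.fderiv_fderiv_comm (stdVec n j) (stdVec n k),
    hf.fderiv_fderiv_comm (Complex.I • stdVec n j) (Complex.I • stdVec n k),
    hf.fderiv_fderiv_comm (stdVec n j) (Complex.I • stdVec n k),
    hf.fderiv_fderiv_comm (Complex.I • stdVec n j) (stdVec n k)]
  simp only [star_mul', star_add, Complex.star_def, Complex.conj_ofReal, Complex.conj_I, map_div₀,
    map_one, map_ofNat]
  push_cast
  ring

theorem sum_re_smul_stdVec_add (u : Cn n) :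
    u = ∑ j, ((u j).re • stdVec n j + (u j).im • (Complex.I • stdVec n j)) := by
  ext i
  simp only [WithLp.ofLp_sum, WithLp.ofLp_add, WithLp.ofLp_smul, Finset.sum_apply, Pi.add_apply,
    Pi.smul_apply, stdVec, PiLp.single_apply]
  rw [Finset.sum_eq_single i]
  · simp [Complex.re_add_im]
  · intro j _ hj; simp [hj.symm]
  · simp

theorem bilin_apply_eq_sum (H : Cn n →L[ℝ] Cn n →L[ℝ] ℝ) (u : Cn n) :
    H u u = ∑ j, ∑ k, ((u j).re * (u k).re * H (stdVec n j) (stdVec n k)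
      + (u j).re * (u k).im * H (stdVec n j) (Complex.I • stdVec n k)
      + (u j).im * (u k).re * H (Complex.I • stdVec n j) (stdVec n k)
      + (u j).im * (u k).im * H (Complex.I • stdVec n j) (Complex.I • stdVec n k)) := by
  have h1 : ∀ w : Cn n, H w u = ∑ k, ((u k).re * H w (stdVec n k)
      + (u k).im * H w (Complex.I • stdVec n k)) := fun w => by
    conv_lhs => rw [sum_re_smul_stdVec_add u]
    simp only [map_sum, map_add, map_smul, smul_eq_mul]
  have h2 : H u u = ∑ j, ((u j).re * H (stdVec n j) u
      + (u j).im * H (Complex.I • stdVec n j) u) := by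
    have := congrArg (fun w => H w u) (sum_re_smul_stdVec_add u)
    simp only [map_sum, map_add, map_smul, _root_.sum_apply, _root_.add_apply, _root_.smul_apply,
      smul_eq_mul] at this
    exact this
  rw [h2]
  refine Finset.sum_congr rfl fun j _ => ?_
  rw [h1, h1, Finset.mul_sum, Finset.mul_sum, ← Finset.sum_add_distrib]
  refine Finset.sum_congr rfl fun k _ => ?_
  ring

/-- The Levi form `∑ f_{jk̄} ξ_j conj ξ_k` is a quarter of the sum of the second derivatives in the
directions `ξ` and `iξ`. -/
theorem re_sum_complexHessian {f : Cn n → ℝ} {z : Cn n} (hf : ContDiffAt ℝ 2 f z) (ξ : Cn n) :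
    (∑ j, ∑ k, ξ j * conj (ξ k) * complexHessian f z j k).re
      = (1 / 4) * (fderiv ℝ (fderiv ℝ f) z ξ ξ
        + fderiv ℝ (fderiv ℝ f) z (Complex.I • ξ) (Complex.I • ξ)) := by
  rw [bilin_apply_eq_sum _ ξ, bilin_apply_eq_sum _ (Complex.I • ξ), ← Finset.sum_add_distrib,
    Complex.re_sum, Finset.mul_sum]
  refine Finset.sum_congr rfl fun j _ => ?_
  rw [← Finset.sum_add_distrib, Complex.re_sum, Finset.mul_sum]
  refine Finset.sum_congr rfl fun k _ => ?_
  rw [complexHessian_apply hf]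
  have h4 : (1 / 4 : ℂ) = ((1 / 4 : ℝ) : ℂ) := by push_cast; rfl
  rw [h4]
  simp only [PiLp.smul_apply, smul_eq_mul, Complex.mul_re, Complex.mul_im, Complex.add_re,
    Complex.add_im, Complex.conj_re, Complex.conj_im, Complex.ofReal_re, Complex.ofReal_im,
    Complex.I_re, Complex.I_im]
  ring

/-- The directions `ξ / 2` and `iξ / 2`, where `ξ` runs over the conjugates of the columns of `Y`. The
operator `sumSqDeriv` along them is `f ↦ tr (Yᴴ (f_{jk̄}) Y)`. -/
noncomputable def leviDirections {m : ℕ} (Y : Matrix (Fin n) (Fin m) ℂ) : Fin m ⊕ Fin m → Cn n :=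
  Sum.elim (fun i => (1 / 2 : ℝ) • WithLp.toLp 2 fun j => conj (Y j i))
    (fun i => (1 / 2 : ℝ) • (Complex.I • WithLp.toLp 2 fun j => conj (Y j i)))

theorem re_trace_complexHessian {m : ℕ} {f : Cn n → ℝ} {z : Cn n} (hf : ContDiffAt ℝ 2 f z)
    (Y : Matrix (Fin n) (Fin m) ℂ) :
    (Yᴴ * complexHessian f z * Y).trace.re = sumSqDeriv (leviDirections Y) f z := by
  rw [sumSqDeriv, Fintype.sum_sum_type, ← Finset.sum_add_distrib, trace, Complex.re_sum]
  refine Finset.sum_congr rfl fun i _ => ?_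
  have h1 := re_sum_complexHessian hf (WithLp.toLp 2 fun j => conj (Y j i))
  have h2 : (Yᴴ * complexHessian f z * Y).diag i
      = ∑ j, ∑ k, conj (Y j i) * conj (conj (Y k i)) * complexHessian f z j k := by
    simp only [diag_apply, Matrix.mul_apply, conjTranspose_apply, Finset.sum_mul, Complex.conj_conj,
      Complex.star_def]
    rw [Finset.sum_comm]
    refine Finset.sum_congr rfl fun j _ => Finset.sum_congr rfl fun k _ => ?_
    ring
  rw [h2]
  simp only at h1
  rw [h1]
  simp only [leviDirections, Sum.elim_inl, Sum.elim_inr, map_smul, _root_.smul_apply, smul_eq_mul]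
  ring

theorem exists_leviDirections_ne_zero {m : ℕ} {Y : Matrix (Fin n) (Fin m) ℂ} (hY : Y ≠ 0) :
    ∃ k, leviDirections Y k ≠ 0 := by
  by_contra! h
  refine hY (Matrix.ext fun j i => ?_)
  have h1 := congrArg (fun w : Cn n => w j) (h (Sum.inl i))
  simpa [leviDirections] using h1

end ComplexHessian

/-! ### Regularization -/

section Regularization

variable {n : ℕ} {ρ : Cn n → ℝ}

/-- The rescaled mollifier `δ^{-2n} ρ(y / δ)`. -/
noncomputable def mollifierKernel (ρ : Cn n → ℝ) (δ : ℝ) (y : Cn n) : ℝ :=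
  |(δ ^ Module.finrank ℝ (Cn n))⁻¹| * ρ (δ⁻¹ • y)

theorem integral_comp_sub_smul_mul (g : Cn n → ℝ) {δ : ℝ} (hδ : 0 < δ) (z : Cn n) :
    ∫ w, g (z - δ • w) * ρ w = ∫ t, g t * mollifierKernel ρ δ (z - t) := by
  have h1 : ∀ w, g (z - δ • w) * ρ w
      = (fun y => g (z - y) * ρ (δ⁻¹ • y)) (δ • w) := fun w => by
    simp only [inv_smul_smul₀ hδ.ne']
  rw [integral_congr_ae (Filter.Eventually.of_forall h1),
    Measure.integral_comp_smul volume (fun y => g (z - y) * ρ (δ⁻¹ • y)) δ,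
    ← integral_sub_left_eq_self _ _ z, smul_eq_mul,
    ← integral_const_mul]
  refine integral_congr_ae (Filter.Eventually.of_forall fun t => ?_)
  simp only [mollifierKernel, sub_sub_cancel]
  ring

theorem regularization_eq (φ : Cn n → EReal) {δ : ℝ} (hδ : 0 < δ) (z : Cn n) :
    regularization ρ φ δ z = ∫ t, (φ t).toReal * mollifierKernel ρ δ (z - t) :=
  integral_comp_sub_smul_mul (fun t => (φ t).toReal) hδ z

namespace IsMollifier

variable (hρ : IsMollifier ρ) {δ : ℝ} (hδ : 0 < δ)

include hρ

theorem kernel_nonneg (y : Cn n) : 0 ≤ mollifierKernel ρ δ y :=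
  mul_nonneg (abs_nonneg _) (hρ.nonneg _)

theorem contDiff_kernel : ContDiff ℝ ((⊤ : ℕ∞) : WithTop ℕ∞) (mollifierKernel ρ δ) :=
  contDiff_const.mul (hρ.smooth.comp (contDiff_const_smul _))

theorem continuous_kernel : Continuous (mollifierKernel ρ δ) := hρ.contDiff_kernel.continuous

theorem hasCompactSupport : HasCompactSupport ρ :=
  HasCompactSupport.intro (isCompact_closedBall (0 : Cn n) 1) fun w hw => hρ.support w (by
    simpa using hw)

theorem exists_bound : ∃ C, 0 < C ∧ ∀ w, ρ w ≤ C := by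
  obtain ⟨C, hC⟩ := hρ.hasCompactSupport.exists_bound_of_continuous hρ.smooth.continuous
  exact ⟨max C 1, by positivity, fun w =>
    ((le_abs_self _).trans (hC w)).trans (le_max_left _ _)⟩

include hδ

theorem kernel_eq_zero {y : Cn n} (hy : δ < ‖y‖) : mollifierKernel ρ δ y = 0 := by
  rw [mollifierKernel, hρ.support, mul_zero]
  rw [norm_smul, norm_inv, Real.norm_of_nonneg hδ.le, inv_mul_eq_div, lt_div_iff₀ hδ]
  simpa using hy

theorem hasCompactSupport_kernel : HasCompactSupport (mollifierKernel ρ δ) :=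
  HasCompactSupport.intro (isCompact_closedBall (0 : Cn n) δ) fun w hw =>
    hρ.kernel_eq_zero hδ (by simpa using hw)

theorem integral_kernel (z : Cn n) : ∫ t, mollifierKernel ρ δ (z - t) = 1 := by
  have := integral_comp_sub_smul_mul (ρ := ρ) (fun _ => 1) hδ z
  simp only [one_mul, hρ.integral] at this
  exact this.symm

theorem exists_kernel_bound : ∃ C, 0 < C ∧ ∀ y, mollifierKernel ρ δ y ≤ C := by
  obtain ⟨C, hC0, hC⟩ := hρ.exists_bound
  refine ⟨|(δ ^ Module.finrank ℝ (Cn n))⁻¹| * C, by positivity, fun y => ?_⟩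
  exact mul_le_mul_of_nonneg_left (hC _) (abs_nonneg _)

theorem integrable_mul_kernel {u : Cn n → ℝ} (hu : Integrable u) (z : Cn n) :
    Integrable fun t => u t * mollifierKernel ρ δ (z - t) := by
  obtain ⟨C, -, hC⟩ := hρ.exists_kernel_bound hδ
  refine hu.mul_bdd (c := C)
    (hρ.continuous_kernel.comp (continuous_const.sub continuous_id)).aestronglyMeasurable ?_
  refine Filter.Eventually.of_forall fun t => ?_
  rw [Real.norm_of_nonneg (hρ.kernel_nonneg _)]
  exact hC _

theorem integrable_continuous_mul_kernel {g : Cn n → ℝ} (hg : Continuous g) (z : Cn n) :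
    Integrable fun t => g t * mollifierKernel ρ δ (z - t) := by
  refine (hg.mul (hρ.continuous_kernel.comp
    (continuous_const.sub continuous_id))).integrable_of_hasCompactSupport ?_
  refine HasCompactSupport.intro (isCompact_closedBall z δ) fun t ht => ?_
  change g t * mollifierKernel ρ δ (z - t) = 0
  rw [hρ.kernel_eq_zero hδ, mul_zero]
  rw [← dist_eq_norm, dist_comm]
  simpa using ht

theorem mul_kernel_eq_indicator {K : Set (Cn n)} {z : Cn n} (hK : Metric.closedBall z δ ⊆ K)
    (u : Cn n → ℝ) (t : Cn n) :
    u t * mollifierKernel ρ δ (z - t) = K.indicator u t * mollifierKernel ρ δ (z - t) := by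
  by_cases ht : t ∈ K
  · rw [Set.indicator_of_mem ht]
  · rw [hρ.kernel_eq_zero hδ, mul_zero, mul_zero]
    by_contra! h
    exact ht (hK (by rwa [Metric.mem_closedBall, dist_comm, dist_eq_norm]))

theorem regularization_eq_indicator {K : Set (Cn n)} {z : Cn n} (hK : Metric.closedBall z δ ⊆ K)
    (φ : Cn n → EReal) : regularization ρ φ δ z
      = ∫ t, K.indicator (fun t => (φ t).toReal) t * mollifierKernel ρ δ (z - t) := by
  rw [regularization_eq φ hδ]
  exact integral_congr_ae (Filter.Eventually.of_forall fun t =>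
    hρ.mul_kernel_eq_indicator hδ hK (fun t => (φ t).toReal) t)

/-- Convolution of an integrable function with the kernel is smooth. -/
theorem contDiff_convolution {u : Cn n → ℝ} (hu : Integrable u) :
    ContDiff ℝ 2 fun z => ∫ t, u t * mollifierKernel ρ δ (z - t) := by
  have := (hρ.hasCompactSupport_kernel hδ).contDiff_convolution_right (μ := volume) (n := 2)
    (ContinuousLinearMap.mul ℝ ℝ) hu.locallyIntegrable
    ((hρ.contDiff_kernel (δ := δ)).of_le (by exact_mod_cast le_top))
  exact this

/-- Near a point whose closed `δ`-ball lies in the domain, the regularization agrees with a globally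
defined function of class `C²`. -/
theorem regularization_eqOn {φ : Cn n → EReal} {z : Cn n} {R : ℝ} {y : Cn n}
    (hy : dist y z + δ ≤ R) : regularization ρ φ δ y
      = ∫ t, (Metric.closedBall z R).indicator (fun t => (φ t).toReal) t *
        mollifierKernel ρ δ (y - t) :=
  hρ.regularization_eq_indicator hδ (Metric.closedBall_subset_closedBall' (by linarith)) φ

theorem regularization_le {φ : Cn n → EReal} {z : Cn n}
    (hint : IntegrableOn (fun t => (φ t).toReal) (Metric.closedBall z δ))
    (hbot : ∀ᵐ t, t ∈ Metric.closedBall z δ → φ t ≠ ⊥) {g : Cn n → ℝ} (hg : Continuous g)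
    (hle : ∀ t ∈ Metric.closedBall z δ, φ t ≤ (g t : EReal)) :
    regularization ρ φ δ z ≤ ∫ t, g t * mollifierKernel ρ δ (z - t) := by
  rw [hρ.regularization_eq_indicator hδ subset_rfl]
  refine integral_mono_ae
    (hρ.integrable_mul_kernel hδ
      (hint.integrable_indicator Metric.isClosed_closedBall.measurableSet) z)
    (hρ.integrable_continuous_mul_kernel hδ hg z) ?_
  filter_upwards [hbot] with t ht
  by_cases htz : t ∈ Metric.closedBall z δ
  · simp only [Set.indicator_of_mem htz]
    refine mul_le_mul_of_nonneg_right ?_ (hρ.kernel_nonneg _)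
    have h1 := hle t htz
    have h2 := EReal.toReal_le_toReal h1 (ht htz) (EReal.coe_ne_top _)
    simpa using h2
  · have : mollifierKernel ρ δ (z - t) = 0 := hρ.kernel_eq_zero hδ (by
      rw [← dist_eq_norm, dist_comm]; simpa using htz)
    simp [this]

theorem regularization_le_const {φ : Cn n → EReal} {z : Cn n}
    (hint : IntegrableOn (fun t => (φ t).toReal) (Metric.closedBall z δ))
    (hbot : ∀ᵐ t, t ∈ Metric.closedBall z δ → φ t ≠ ⊥) {M : ℝ}
    (hle : ∀ t ∈ Metric.closedBall z δ, φ t ≤ (M : EReal)) :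
    regularization ρ φ δ z ≤ M := by
  have := hρ.regularization_le hδ hint hbot (g := fun _ => M) continuous_const hle
  rwa [integral_const_mul, hρ.integral_kernel hδ, mul_one] at this

omit hδ

/-- At almost every point the regularizations converge, by the Lebesgue differentiation theorem. -/
theorem ae_tendsto_convolution {u : Cn n → ℝ} (hu : Integrable u) :
    ∀ᵐ z, Filter.Tendsto (fun δ => ∫ t, u t * mollifierKernel ρ δ (z - t))
      (nhdsWithin 0 (Set.Ioi 0)) (nhds (u z)) := by
  obtain ⟨C, hC0, hC⟩ := hρ.exists_bound
  filter_upwards [(Besicovitch.vitaliFamily volume).ae_tendsto_average_norm_sub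
    hu.locallyIntegrable] with z hz
  have h1 := hz.comp (Besicovitch.tendsto_filterAt volume z)
  have h2 := tendsto_integral_smul_of_tendsto_average_norm_sub
    (g := fun δ t => mollifierKernel ρ δ (z - t))
    (C * volume.real (Metric.closedBall (0 : Cn n) 1)) h1
    (Filter.Eventually.of_forall fun δ => hu.integrableOn)
    (by
      refine tendsto_const_nhds.congr' ?_
      filter_upwards [self_mem_nhdsWithin] with δ hδ
      exact (hρ.integral_kernel hδ z).symm)
    (by
      filter_upwards [self_mem_nhdsWithin] with δ hδ t ht
      by_contra! h
      refine ht (hρ.kernel_eq_zero hδ ?_)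
      rw [← dist_eq_norm, dist_comm]
      simpa using h)
    (by
      filter_upwards [self_mem_nhdsWithin] with δ hδ t
      have hδ' : (0 : ℝ) < δ := hδ
      rw [abs_of_nonneg (hρ.kernel_nonneg _), Measure.addHaar_real_closedBall' volume z hδ'.le,
        mollifierKernel, abs_of_pos (by positivity)]
      have hpos : 0 < volume.real (Metric.closedBall (0 : Cn n) 1) := by
        rw [measureReal_def]
        exact ENNReal.toReal_pos (Metric.measure_closedBall_pos _ _ one_pos).ne'
          (isCompact_closedBall _ _).measure_lt_top.ne
      have hpow : 0 < δ ^ Module.finrank ℝ (Cn n) := pow_pos hδ' _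
      rw [le_div_iff₀ (by positivity)]
      have e : (δ ^ Module.finrank ℝ (Cn n))⁻¹ * ρ (δ⁻¹ • (z - t)) *
          (δ ^ Module.finrank ℝ (Cn n) * volume.real (Metric.closedBall (0 : Cn n) 1))
          = ρ (δ⁻¹ • (z - t)) * volume.real (Metric.closedBall (0 : Cn n) 1) := by
        field_simp
      rw [e]
      exact mul_le_mul_of_nonneg_right (hC _) hpos.le)
  refine h2.congr fun δ => ?_
  refine integral_congr_ae (Filter.Eventually.of_forall fun t => ?_)
  simp [mul_comm]

end IsMollifier

end Regularization

/-! ### Continuous majorants of upper semicontinuous functions -/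

section Majorants

variable {n : ℕ}

theorem UpperSemicontinuousOn.exists_real_bound {φ : Cn n → EReal} {K : Set (Cn n)}
    (husc : UpperSemicontinuousOn φ K) (hK : IsCompact K) (hlt : ∀ z ∈ K, φ z < ⊤) :
    ∃ M : ℝ, 0 ≤ M ∧ ∀ z ∈ K, φ z ≤ (M : EReal) := by
  rcases K.eq_empty_or_nonempty with rfl | hne
  · exact ⟨0, le_rfl, by simp⟩
  obtain ⟨x, hx, hmax⟩ := husc.exists_isMaxOn hne hK
  refine ⟨max (φ x).toReal 0, le_max_right _ _, fun z hz => (hmax hz).trans ?_⟩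
  refine (EReal.le_coe_toReal (hlt x hx).ne).trans ?_
  exact_mod_cast le_max_left _ _

/-- An upper semicontinuous integrable function on a compact set has continuous majorants that are
close to it in `L¹`: truncations of `x ↦ sup_y (φ y - k |x - y|)`. -/
theorem exists_continuous_ge_integral_lt {K : Set (Cn n)} (hK : IsCompact K) {φ : Cn n → EReal}
    (husc : UpperSemicontinuousOn φ K) (hlt : ∀ z ∈ K, φ z < ⊤)
    (hint : IntegrableOn (fun t => (φ t).toReal) K) (hbot : ∀ᵐ t, t ∈ K → φ t ≠ ⊥)
    {ε : ℝ} (hε : 0 < ε) :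
    ∃ f : Cn n → ℝ, Continuous f ∧ (∃ M, ∀ x, |f x| ≤ M) ∧ (∀ x ∈ K, φ x ≤ (f x : EReal)) ∧
      ∫ t in K, (f t - (φ t).toReal) < ε := by
  rcases K.eq_empty_or_nonempty with rfl | hne
  · exact ⟨fun _ => 0, continuous_const, ⟨0, by simp⟩, by simp, by simpa using hε⟩
  have : Nonempty K := hne.to_subtype
  obtain ⟨M, hM0, hM⟩ := husc.exists_real_bound hK hlt
  set g : ℕ → Cn n → ℝ := fun k y => (max (φ y) ((-(k : ℝ) : ℝ) : EReal)).toReal with hg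
  have hgcoe : ∀ k, ∀ y ∈ K, ((g k y : ℝ) : EReal) = max (φ y) ((-(k : ℝ) : ℝ) : EReal) :=
    fun k y hy => EReal.coe_toReal (max_lt (hlt y hy) (EReal.coe_lt_top _)).ne
      (lt_of_lt_of_le (EReal.bot_lt_coe _) (le_max_right _ _)).ne'
  have hgM : ∀ k, ∀ y ∈ K, g k y ≤ M := fun k y hy => by
    have h1 : ((g k y : ℝ) : EReal) ≤ (M : EReal) := by
      rw [hgcoe k y hy]
      refine max_le (hM y hy) ?_
      have : -(k : ℝ) ≤ M := by linarith [(Nat.cast_nonneg k : (0 : ℝ) ≤ k)]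
      exact_mod_cast this
    exact_mod_cast h1
  have hφg : ∀ k, ∀ y ∈ K, φ y ≤ ((g k y : ℝ) : EReal) := fun k y hy => by
    rw [hgcoe k y hy]; exact le_max_left _ _
  set s : ℕ → Cn n → ℝ := fun k x => ⨆ y : K, (g k y - k * dist x (y : Cn n)) with hs
  have hbdd : ∀ (k : ℕ) (x : Cn n),
      BddAbove (Set.range fun y : K => g k y - k * dist x (y : Cn n)) := fun k x => by
    refine ⟨M, ?_⟩
    rintro _ ⟨y, rfl⟩
    have h1 := hgM k y y.2
    have h2 : 0 ≤ (k : ℝ) * dist x (y : Cn n) := by positivity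
    simp only
    linarith
  have hslip : ∀ k : ℕ, LipschitzWith (k : NNReal) (s k) := fun k => by
    refine LipschitzWith.of_le_add_mul _ fun x x' => ?_
    refine ciSup_le fun y => ?_
    have h1 := le_ciSup (hbdd k x') y
    have h2 : dist x' y ≤ dist x' x + dist x y := dist_triangle _ _ _
    have h3 : (k : ℝ) * dist x' y ≤ k * (dist x x' + dist x y) := by
      rw [dist_comm x x']
      exact mul_le_mul_of_nonneg_left h2 (Nat.cast_nonneg k)
    change _ ≤ s k x' + _
    have h4 : g k y - k * dist x' y ≤ s k x' := h1
    simp only [NNReal.coe_natCast]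
    linarith
  have hsM : ∀ k x, s k x ≤ M := fun k x => ciSup_le fun y => by
    have h1 := hgM k y y.2
    have h2 : 0 ≤ (k : ℝ) * dist x (y : Cn n) := by positivity
    linarith
  have hgs : ∀ k, ∀ x ∈ K, g k x ≤ s k x := fun k x hx => by
    have h1 := le_ciSup (hbdd k x) ⟨x, hx⟩
    simpa using h1
  set f : ℕ → Cn n → ℝ := fun k x => max (s k x) (-k) with hf
  have hfcont : ∀ k, Continuous (f k) := fun k => (hslip k).continuous.max continuous_const
  have hfM : ∀ k x, f k x ≤ M := fun k x => max_le (hsM k x) (by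
    linarith [(Nat.cast_nonneg k : (0 : ℝ) ≤ k)])
  have hφf : ∀ k, ∀ x ∈ K, φ x ≤ (f k x : EReal) := fun k x hx => by
    refine (hφg k x hx).trans ?_
    exact_mod_cast (hgs k x hx).trans (le_max_left _ _)
  have hreal : ∀ x ∈ K, φ x ≠ ⊥ → ((φ x).toReal : EReal) = φ x := fun x hx hb =>
    EReal.coe_toReal (hlt x hx).ne hb
  have hle : ∀ k, ∀ x ∈ K, φ x ≠ ⊥ → (φ x).toReal ≤ f k x := fun k x hx hb => by
    have := hφf k x hx
    rw [← hreal x hx hb] at this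
    exact_mod_cast this
  have hlim : ∀ x ∈ K, φ x ≠ ⊥ →
      Filter.Tendsto (fun k => f k x - (φ x).toReal) Filter.atTop (nhds 0) := by
    intro x hx hb
    rw [Metric.tendsto_atTop]
    intro e he
    set p := (φ x).toReal with hp
    have hlt' : φ x < ((p + e / 2 : ℝ) : EReal) := by
      rw [← hreal x hx hb]
      exact_mod_cast (by linarith : p < p + e / 2)
    obtain ⟨η, hη, hball⟩ := Metric.mem_nhdsWithin_iff.1 (husc x hx _ hlt')
    obtain ⟨N, hN⟩ := exists_nat_ge (max (-p) ((M - p) / η))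
    refine ⟨N, fun k hk => ?_⟩
    have hk1 : max (-p) ((M - p) / η) ≤ k := hN.trans (by exact_mod_cast hk)
    have hkp : -(k : ℝ) ≤ p := by linarith [(le_max_left _ _).trans hk1]
    have hkη : M - p ≤ k * η := (div_le_iff₀ hη).1 ((le_max_right _ _).trans hk1)
    have hup : f k x ≤ p + e / 2 := by
      refine max_le (ciSup_le fun y => ?_) (by linarith)
      by_cases hy : dist (y : Cn n) x < η
      · have h1 : φ y < ((p + e / 2 : ℝ) : EReal) := hball ⟨hy, y.2⟩
        have h2 : ((g k y : ℝ) : EReal) ≤ ((p + e / 2 : ℝ) : EReal) := by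
          rw [hgcoe k y y.2]
          exact max_le h1.le (by exact_mod_cast (by linarith : -(k : ℝ) ≤ p + e / 2))
        have h3 : g k y ≤ p + e / 2 := by exact_mod_cast h2
        have h4 : 0 ≤ (k : ℝ) * dist x (y : Cn n) := by positivity
        linarith
      · have h1 := hgM k y y.2
        have h2 : (k : ℝ) * η ≤ k * dist x y := by
          rw [dist_comm]
          exact mul_le_mul_of_nonneg_left (not_lt.1 hy) (Nat.cast_nonneg k)
        linarith
    have hlow := hle k x hx hb
    rw [Real.dist_eq, sub_zero, abs_of_nonneg (by linarith)]
    linarith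
  have hbot' : ∀ᵐ t ∂(volume.restrict K), φ t ≠ ⊥ :=
    (ae_restrict_iff' hK.measurableSet).2 hbot
  have hconv : Filter.Tendsto (fun k => ∫ t in K, (f k t - (φ t).toReal)) Filter.atTop
      (nhds (∫ t in K, (0 : ℝ))) := by
    refine tendsto_integral_of_dominated_convergence (fun t => M + ‖(φ t).toReal‖)
      (fun k => (hfcont k).aestronglyMeasurable.sub hint.aestronglyMeasurable)
      ((integrableOn_const hK.measure_lt_top.ne).add hint.norm) (fun k => ?_) ?_
    · filter_upwards [hbot', ae_restrict_mem hK.measurableSet] with t ht htK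
      have h1 := hle k t htK ht
      rw [Real.norm_of_nonneg (by linarith), Real.norm_eq_abs]
      linarith [hfM k t, neg_abs_le (φ t).toReal]
    · filter_upwards [hbot', ae_restrict_mem hK.measurableSet] with t ht htK
      exact hlim t htK ht
  rw [integral_zero] at hconv
  obtain ⟨k, hk⟩ := (hconv.eventually_lt_const hε).exists
  refine ⟨f k, hfcont k, ⟨M + k, fun x => abs_le.2 ⟨?_, ?_⟩⟩, hφf k, hk⟩
  · have : -(k : ℝ) ≤ f k x := le_max_right _ _
    linarith
  · linarith [hfM k x, (Nat.cast_nonneg k : (0 : ℝ) ≤ k)]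

theorem exists_lt_closedBall_subset {O : Set (Cn n)} (hO : IsOpen O) {z : Cn n} {δ : ℝ}
    (hδ : 0 ≤ δ) (h : Metric.closedBall z δ ⊆ O) : ∃ R, δ < R ∧ Metric.closedBall z R ⊆ O := by
  obtain ⟨η, hη, hsub⟩ := (isCompact_closedBall z δ).exists_cthickening_subset_open hO h
  refine ⟨δ + η, by linarith, ?_⟩
  rwa [cthickening_closedBall hη.le hδ, add_comm] at hsub

end Majorants

/-! ### Regularizations of viscosity subsolutions -/

section Viscosity

variable {n : ℕ} {ρ : Cn n → ℝ} {κ : Type*} [Fintype κ] {v : κ → Cn n}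

/-- A viscosity subsolution of a linear equation with constant coefficients satisfies the mean value
inequality for the harmonic measure, hence so do its regularizations; for a function of class `C²`
this forces the differential inequality. -/
theorem IsMollifier.le_sumSqDeriv_regularization (hρ : IsMollifier ρ) (hv : ∃ k, v k ≠ 0)
    {O : Set (Cn n)} (hO : IsOpen O) {φ : Cn n → EReal} (husc : UpperSemicontinuousOn φ O)
    (hlt : ∀ z ∈ O, φ z < ⊤) (hbot : ∀ᵐ z ∂(volume.restrict O), φ z ≠ ⊥)
    (hloc : LocallyIntegrableOn (fun z => (φ z).toReal) O volume) {b : ℝ}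
    (htest : ∀ x ∈ O, ∀ V ⊆ O, ∀ q, IsUpperTest φ x V q → b ≤ sumSqDeriv v q x)
    {δ : ℝ} (hδ : 0 < δ) {z : Cn n} (hz : Metric.closedBall z δ ⊆ O) :
    b ≤ sumSqDeriv v (regularization ρ φ δ) z := by
  obtain ⟨R, hRδ, hRO⟩ := exists_lt_closedBall_subset hO hδ.le hz
  obtain ⟨μ, hμ1, hμ2, hμ3⟩ := exists_harmonicMeasure hv
  have hμ : IsHarmonicMeasure v μ := ⟨hμ1, hμ2, hμ3⟩
  set K := Metric.closedBall z R with hK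
  have hKc : IsCompact K := isCompact_closedBall z R
  have hKint : IntegrableOn (fun t => (φ t).toReal) K :=
    hloc.integrableOn_compact_subset hRO hKc
  have hKbot : ∀ᵐ t, t ∈ K → φ t ≠ ⊥ := by
    filter_upwards [(ae_restrict_iff' hO.measurableSet).1 hbot] with t ht htK
    exact ht (hRO htK)
  set u : Cn n → ℝ := K.indicator fun t => (φ t).toReal with hu
  have huint : Integrable u := hKint.integrable_indicator hKc.measurableSet
  set F : Cn n → ℝ := fun y => ∫ t, u t * mollifierKernel ρ δ (y - t) with hF
  have hFC : ContDiff ℝ 2 F := hρ.contDiff_convolution hδ huint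
  have hFeq : ∀ y, dist y z + δ ≤ R → regularization ρ φ δ y = F y := fun y hy =>
    hρ.regularization_eqOn hδ hy
  have hnear : regularization ρ φ δ =ᶠ[nhds z] F := by
    filter_upwards [Metric.ball_mem_nhds z (sub_pos.2 hRδ)] with y hy
    exact hFeq y (by linarith [Metric.mem_ball.1 hy])
  rw [hnear.sumSqDeriv_eq]
  by_contra! hcon
  -- if the inequality fails at `z`, the operator applied to `F` stays below some `b' < b` near `z`,
  -- and the mean value inequalities for `-F` and `F` with the constants `b'` and `b` are incompatible
  set b' := (b + sumSqDeriv v F z) / 2 with hb'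
  have hLF : ContinuousOn (sumSqDeriv v F) Set.univ :=
    hFC.contDiffOn.continuousOn_sumSqDeriv v isOpen_univ
  have hev : ∀ᶠ y in nhds z, sumSqDeriv v F y < b' :=
    (continuousOn_univ.1 hLF).continuousAt.eventually_lt_const (by linarith)
  obtain ⟨r₀, hr₀, hr₀b⟩ := Metric.eventually_nhds_iff_ball.1 hev
  set r := min (r₀ / 2) (R - δ) with hr
  have hrpos : 0 < r := lt_min (by linarith) (by linarith)
  have hrδ : r + δ ≤ R := by linarith [min_le_right (r₀ / 2) (R - δ)]
  have hLb : ∀ y ∈ Metric.closedBall z r, sumSqDeriv v F y < b' := fun y hy => by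
    refine hr₀b y (Metric.mem_ball.2 ?_)
    have h1 := Metric.mem_closedBall.1 hy
    have h2 := min_le_left (r₀ / 2) (R - δ)
    linarith
  set ℓ := 2 * ∑ k, ‖v k‖ ^ 2 with hℓ
  have hℓpos : 0 < ℓ := sum_norm_sq_pos hv
  have hFr : Continuous fun w => F (z + r • w) :=
    hFC.continuous.comp (continuous_const.add (continuous_const_smul r))
  -- the mean value inequality for `-F`, from the upper bound for the operator on `F`
  have hmeanF : ∫ w, F (z + r • w) ∂μ ≤ F z + b' * r ^ 2 / ℓ := by
    have h1 := hμ.le_integral hv (φ := fun y => ((-F y : ℝ) : EReal)) (a := z) hrpos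
      ((continuous_coe_real_ereal.comp
        hFC.continuous.neg).upperSemicontinuous.upperSemicontinuousOn _)
      (fun _ _ => EReal.coe_lt_top _) (b := -b')
      (fun x hx V _ q hq => by
        have h2 := hq.sumSqDeriv_le (v := v) (f := fun y => -F y) hFC.contDiffAt.neg
        rw [sumSqDeriv_neg] at h2
        linarith [hLb x (Metric.ball_subset_closedBall hx)])
      (f := fun w => -F (z + r • w)) hFr.neg (fun w _ => le_rfl)
    rw [integral_neg] at h1
    have h2 : -F z ≤ -∫ w, F (z + r • w) ∂μ - -b' * r ^ 2 / ℓ := by exact_mod_cast h1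
    have h3 : -b' * r ^ 2 / ℓ = -(b' * r ^ 2 / ℓ) := by ring
    linarith
  -- the mean value inequality for `F`, from that for `φ`; the harmonic measure is applied to a
  -- continuous majorant `f` close to `φ` in `L¹`, the values of `φ` on a sphere being uncontrolled
  obtain ⟨C, hC0, hC⟩ := hρ.exists_kernel_bound hδ
  have hbb : 0 < b - b' := by rw [hb']; linarith
  obtain ⟨f, hfc, ⟨M, hfM⟩, hφf, hfint⟩ := exists_continuous_ge_integral_lt hKc (husc.mono hRO)
    (fun y hy => hlt y (hRO hy)) hKint hKbot
    (ε := (b - b') * r ^ 2 / ℓ / C) (by positivity)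
  have hcontfr : ∀ t, Continuous fun w => f (t + r • w) := fun t =>
    hfc.comp (continuous_const.add (continuous_const_smul r))
  set g : Cn n → ℝ := fun t => ∫ w, f (t + r • w) ∂μ with hg
  have hgc : Continuous g := by
    refine continuous_of_dominated (bound := fun _ => M)
      (fun t => (hcontfr t).aestronglyMeasurable)
      (fun t => Filter.Eventually.of_forall fun w => by
        rw [Real.norm_eq_abs]; exact hfM _) (integrable_const _)
      (Filter.Eventually.of_forall fun w => hfc.comp (continuous_id.add continuous_const))
  have hδK : ∀ {y : Cn n}, dist y z ≤ r → Metric.closedBall y δ ⊆ K := fun hy =>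
    Metric.closedBall_subset_closedBall' (by linarith)
  have hzK : Metric.closedBall z δ ⊆ K := Metric.closedBall_subset_closedBall hRδ.le
  have hφg : ∀ t ∈ Metric.closedBall z δ, φ t ≤ ((g t - b * r ^ 2 / ℓ : ℝ) : EReal) := by
    intro t ht
    have htK : Metric.closedBall t r ⊆ K :=
      Metric.closedBall_subset_closedBall' (by linarith [Metric.mem_closedBall.1 ht])
    refine hμ.le_integral hv hrpos (husc.mono (htK.trans hRO)) (fun y hy => hlt y (hRO (htK hy)))
      (fun x hx V hV q hq => htest x (hRO (htK (Metric.ball_subset_closedBall hx))) V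
        ((hV.trans Metric.ball_subset_closedBall).trans (htK.trans hRO)) q hq)
      (hcontfr t) (fun w hw => hφf _ (htK ?_))
    rw [Metric.mem_closedBall, dist_eq_norm, add_sub_cancel_left, norm_smul, hw, mul_one,
      Real.norm_of_nonneg hrpos.le]
  have hmeanφ : F z ≤ (∫ t, g t * mollifierKernel ρ δ (z - t)) - b * r ^ 2 / ℓ := by
    have h1 := hρ.regularization_le hδ (hKint.mono_set hzK)
      (hKbot.mono fun t ht h => ht (hzK h)) (g := fun t => g t - b * r ^ 2 / ℓ)
      (hgc.sub continuous_const) hφg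
    rw [hFeq z (by rw [dist_self]; linarith)] at h1
    simp only [sub_mul] at h1
    rwa [integral_sub (hρ.integrable_continuous_mul_kernel hδ hgc z)
      (hρ.integrable_continuous_mul_kernel hδ continuous_const z), integral_const_mul,
      hρ.integral_kernel hδ, mul_one] at h1
  have hprod : Integrable
      (Function.uncurry fun (t w : Cn n) => f (t + r • w) * mollifierKernel ρ δ (z - t))
      (volume.prod μ) := by
    have hκ : Integrable fun t : Cn n => M * mollifierKernel ρ δ (z - t) :=
      hρ.integrable_continuous_mul_kernel hδ continuous_const z
    refine Integrable.mono' (hκ.comp_fst μ) ?_ (Filter.Eventually.of_forall fun p => ?_)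
    · refine Continuous.aestronglyMeasurable ?_
      have h1 : Continuous fun p : Cn n × Cn n => f (p.1 + r • p.2) :=
        hfc.comp (continuous_fst.add (continuous_snd.const_smul r))
      have h2 : Continuous fun p : Cn n × Cn n => mollifierKernel ρ δ (z - p.1) :=
        hρ.continuous_kernel.comp (continuous_const.sub continuous_fst)
      exact h1.mul h2
    · simp only [Function.uncurry]
      rw [norm_mul, Real.norm_of_nonneg (hρ.kernel_nonneg (δ := δ) _), Real.norm_eq_abs]
      exact mul_le_mul_of_nonneg_right (hfM _) (hρ.kernel_nonneg _)
  have hswap : ∫ t, g t * mollifierKernel ρ δ (z - t)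
      = ∫ w, (∫ t, f (t + r • w) * mollifierKernel ρ δ (z - t)) ∂μ := by
    rw [← integral_integral_swap hprod]
    refine integral_congr_ae (Filter.Eventually.of_forall fun t => ?_)
    simp only [hg]
    rw [integral_mul_const]
  have hinner : ∀ w : Cn n, ‖w‖ = 1 → ∫ t, f (t + r • w) * mollifierKernel ρ δ (z - t)
      ≤ F (z + r • w) + C * ∫ t in K, (f t - (φ t).toReal) := by
    intro w hw
    set y := z + r • w with hy
    have hyK : Metric.closedBall y δ ⊆ K := hδK (by
      rw [hy, dist_eq_norm, add_sub_cancel_left, norm_smul, hw, mul_one,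
        Real.norm_of_nonneg hrpos.le])
    have h1 : ∫ t, f (t + r • w) * mollifierKernel ρ δ (z - t)
        = ∫ s, f s * mollifierKernel ρ δ (y - s) := by
      rw [← integral_add_right_eq_self (fun s => f s * mollifierKernel ρ δ (y - s)) (r • w)]
      refine integral_congr_ae (Filter.Eventually.of_forall fun t => ?_)
      simp only [hy, add_sub_add_right_eq_sub]
    have hdiff : Integrable (K.indicator fun t => f t - (φ t).toReal) :=
      ((hfc.continuousOn.integrableOn_compact hKc).sub hKint).integrable_indicator
        hKc.measurableSet
    have h2 : (∫ s, f s * mollifierKernel ρ δ (y - s)) - F y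
        = ∫ s, K.indicator (fun t => f t - (φ t).toReal) s * mollifierKernel ρ δ (y - s) := by
      change (∫ s, f s * mollifierKernel ρ δ (y - s))
        - (∫ s, u s * mollifierKernel ρ δ (y - s)) = _
      rw [← integral_sub (hρ.integrable_continuous_mul_kernel hδ hfc y)
        (hρ.integrable_mul_kernel hδ huint y)]
      refine integral_congr_ae (Filter.Eventually.of_forall fun s => ?_)
      simp only
      rw [hρ.mul_kernel_eq_indicator hδ hyK f s, hu, ← sub_mul]
      congr 1
      by_cases hs : s ∈ K <;> simp [hs]
    have h3 : ∫ s, K.indicator (fun t => f t - (φ t).toReal) s * mollifierKernel ρ δ (y - s)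
        ≤ ∫ s, C * K.indicator (fun t => f t - (φ t).toReal) s := by
      refine integral_mono_ae (hρ.integrable_mul_kernel hδ hdiff y) (hdiff.const_mul C) ?_
      filter_upwards [hKbot] with s hs
      rw [mul_comm C]
      refine mul_le_mul_of_nonneg_left (hC _) (Set.indicator_apply_nonneg fun hsK => ?_)
      have h4 := EReal.toReal_le_toReal (hφf s hsK) (hs hsK) (EReal.coe_ne_top _)
      rw [EReal.toReal_coe] at h4
      linarith
    rw [integral_const_mul, integral_indicator hKc.measurableSet] at h3
    linarith
  have hint1 : Integrable (fun w => ∫ t, f (t + r • w) * mollifierKernel ρ δ (z - t)) μ :=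
    hprod.integral_prod_right
  have hmeanSum : ∫ w, (∫ t, f (t + r • w) * mollifierKernel ρ δ (z - t)) ∂μ
      ≤ (∫ w, F (z + r • w) ∂μ) + C * ∫ t in K, (f t - (φ t).toReal) := by
    have h1 : ∫ w, (∫ t, f (t + r • w) * mollifierKernel ρ δ (z - t)) ∂μ
        ≤ ∫ w, (F (z + r • w) + C * ∫ t in K, (f t - (φ t).toReal)) ∂μ := by
      refine integral_mono_ae hint1 ((hμ.integrable hFr).add (integrable_const _)) ?_
      filter_upwards [hμ2] with w hw
      exact hinner w hw
    rw [integral_add (hμ.integrable hFr) (integrable_const _)] at h1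
    simpa using h1
  have h4 : C * ∫ t in K, (f t - (φ t).toReal) < (b - b') * r ^ 2 / ℓ := by
    rwa [lt_div_iff₀ hC0, mul_comm] at hfint
  rw [hswap] at hmeanφ
  have h5 : (b - b') * r ^ 2 / ℓ = b * r ^ 2 / ℓ - b' * r ^ 2 / ℓ := by ring
  linarith

end Viscosity

/-! ### Plurisubharmonic functions and null sets -/

section Plurisubharmonic

variable {n : ℕ}

theorem circleMean_le_of_ae_le {φ : Cn n → EReal} {x w : Cn n} {K : ℝ}
    (h : ∀ᵐ t : ℝ, φ (x + Complex.exp (2 * Real.pi * t * Complex.I) • w) ≤ (K : EReal)) :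
    circleMean φ x w ≤ (K : EReal) := by
  have h' := ae_restrict_of_ae (s := Set.Ioc (0 : ℝ) 1) h
  unfold circleMean
  rcases le_or_gt 0 K with hK | hK
  · have h1 : ∫⁻ t in Set.Ioc (0 : ℝ) 1,
        (φ (x + Complex.exp (2 * Real.pi * t * Complex.I) • w)).toENNReal ≤ ENNReal.ofReal K := by
      calc _ ≤ ∫⁻ _ in Set.Ioc (0 : ℝ) 1, ENNReal.ofReal K := lintegral_mono_ae (by
            filter_upwards [h'] with t ht
            simpa using EReal.toENNReal_le_toENNReal ht)
        _ = ENNReal.ofReal K := by simp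
    refine (EReal.sub_le_sub (EReal.coe_ennreal_le_coe_ennreal_iff.2 h1)
      (EReal.coe_ennreal_nonneg _)).trans ?_
    simp [EReal.coe_ennreal_ofReal, max_eq_left hK]
  · have h1 : ∫⁻ t in Set.Ioc (0 : ℝ) 1,
        (φ (x + Complex.exp (2 * Real.pi * t * Complex.I) • w)).toENNReal = 0 := by
      refine lintegral_eq_zero_of_ae_eq_zero ?_
      filter_upwards [h'] with t ht
      exact EReal.toENNReal_of_nonpos (ht.trans (by exact_mod_cast hK.le))
    have h2 : ENNReal.ofReal (-K) ≤ ∫⁻ t in Set.Ioc (0 : ℝ) 1,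
        (-φ (x + Complex.exp (2 * Real.pi * t * Complex.I) • w)).toENNReal := by
      calc ENNReal.ofReal (-K) = ∫⁻ _ in Set.Ioc (0 : ℝ) 1, ENNReal.ofReal (-K) := by simp
        _ ≤ _ := lintegral_mono_ae (by
            filter_upwards [h'] with t ht
            simpa using EReal.toENNReal_le_toENNReal (EReal.neg_le_neg_iff.2 ht))
    rw [h1]
    refine (EReal.sub_le_sub le_rfl (EReal.coe_ennreal_le_coe_ennreal_iff.2 h2)).trans ?_
    simp [EReal.coe_ennreal_ofReal, max_eq_left (by linarith : (0 : ℝ) ≤ -K)]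

/-- An almost everywhere bound near `x` for a plurisubharmonic function holds at `x`: by Fubini's
theorem it holds almost everywhere on almost every small circle about `x`. -/
theorem IsPsh.le_of_ae_le {φ : Cn n → EReal} {U : Set (Cn n)} (hφ : IsPsh φ U) {x : Cn n} {r : ℝ}
    (hr : 0 < r) (hU : Metric.ball x r ⊆ U) {K : ℝ}
    (h : ∀ᵐ y, y ∈ Metric.ball x r → φ y ≤ (K : EReal)) : φ x ≤ (K : EReal) := by
  obtain ⟨N, hN⟩ : ∃ N, N = toMeasurable volume {y | ¬ (y ∈ Metric.ball x r → φ y ≤ (K : EReal))} :=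
    ⟨_, rfl⟩
  have hNm : MeasurableSet N := hN ▸ measurableSet_toMeasurable _ _
  have hN0 : volume N = 0 := by rw [hN, measure_toMeasurable]; exact h
  have hNle : ∀ y ∉ N, y ∈ Metric.ball x r → φ y ≤ (K : EReal) := fun y hy => by
    by_contra hcon
    exact hy (hN ▸ subset_toMeasurable _ _ hcon)
  have hexp : ∀ t : ℝ, ‖Complex.exp (2 * Real.pi * t * Complex.I)‖ = 1 := fun t => by
    simpa using Complex.norm_exp_ofReal_mul_I (2 * Real.pi * t)
  have hmeas : MeasurableSet {p : ℝ × Cn n |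
      x + Complex.exp (2 * Real.pi * p.1 * Complex.I) • p.2 ∉ N} := by
    refine (Continuous.measurable ?_) hNm.compl
    fun_prop
  have h1 : ∀ᵐ t : ℝ, ∀ᵐ w : Cn n, x + Complex.exp (2 * Real.pi * t * Complex.I) • w ∉ N := by
    refine Filter.Eventually.of_forall fun t => ?_
    have ha : Complex.exp (2 * Real.pi * t * Complex.I) ≠ 0 := Complex.exp_ne_zero _
    have hmp : MeasurePreserving
        fun w : Cn n => Complex.exp (2 * Real.pi * t * Complex.I) • w :=
      LinearIsometryEquiv.measurePreserving
        { (LinearEquiv.smulOfNeZero ℂ (Cn n) _ ha).restrictScalars ℝ with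
          norm_map' := fun w => by
            change ‖Complex.exp (2 * Real.pi * t * Complex.I) • w‖ = ‖w‖
            rw [norm_smul, hexp, one_mul] }
    exact ((measurePreserving_add_left volume x).comp hmp).quasiMeasurePreserving.ae
      (measure_eq_zero_iff_ae_notMem.1 hN0)
  have h2 := (Measure.ae_ae_comm hmeas).1 h1
  have h3 : ∃ w ∈ Metric.ball (0 : Cn n) r,
      ∀ᵐ t : ℝ, x + Complex.exp (2 * Real.pi * t * Complex.I) • w ∉ N := by
    by_contra! hcon
    have : volume (Metric.ball (0 : Cn n) r) = 0 :=
      measure_mono_null (fun w hw => hcon w hw) h2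
    exact (Metric.measure_ball_pos volume _ hr).ne' this
  obtain ⟨w, hw, hwt⟩ := h3
  rw [mem_ball_zero_iff] at hw
  refine (hφ.submean x w fun t ht => hU ?_).trans (circleMean_le_of_ae_le ?_)
  · rw [Metric.mem_ball, dist_eq_norm, add_sub_cancel_left, norm_smul]
    exact lt_of_le_of_lt (mul_le_of_le_one_left (norm_nonneg _) ht) hw
  · filter_upwards [hwt] with t ht
    refine hNle _ ht ?_
    rwa [Metric.mem_ball, dist_eq_norm, add_sub_cancel_left, norm_smul, hexp, one_mul]

end Plurisubharmonic

/-! ### Upper tests and regularizations -/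

section Touching

variable {n : ℕ}

theorem exists_isUpperTest {O : Set (Cn n)} (hO : IsOpen O) (hne : O.Nonempty) {φ : Cn n → EReal}
    (husc : UpperSemicontinuousOn φ O) (hlt : ∀ z ∈ O, φ z < ⊤)
    (hbot : ∀ᵐ z ∂(volume.restrict O), φ z ≠ ⊥) :
    ∃ x ∈ O, ∃ V ⊆ O, ∃ q : Cn n → ℝ, IsUpperTest φ x V q := by
  obtain ⟨y, hy, hyb⟩ : ∃ y ∈ O, φ y ≠ ⊥ := by
    by_contra! hcon
    have : volume O = 0 := measure_mono_null (fun z hz => by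
      simpa [hz] using hcon z hz) ((ae_restrict_iff' hO.measurableSet).1 hbot)
    exact (hO.measure_pos volume hne).ne' this
  obtain ⟨s, hs, hsO⟩ := Metric.nhds_basis_closedBall.mem_iff.1 (hO.mem_nhds hy)
  obtain ⟨M, -, hM⟩ := (husc.mono hsO).exists_real_bound (isCompact_closedBall y s)
    fun z hz => hlt z (hsO hz)
  obtain ⟨t, ht⟩ : ∃ t : ℝ, φ y = t := ⟨(φ y).toReal, (EReal.coe_toReal (hlt y hy).ne hyb).symm⟩
  -- a steep paraboloid, equal to `M` on the sphere and below `φ` at the centre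
  set h : Cn n → ℝ := fun z => M + (M - t + 1) * (polyFun y s⁻¹ (normSqPoly n) z - 1) with hh
  obtain ⟨x, hx, m, hm⟩ := exists_isUpperTest_of_lt (h := h) (husc.mono hsO)
    (fun z hz => hlt z (hsO hz))
    (contDiff_const.add (contDiff_const.mul ((contDiff_polyFun _ _ _).sub contDiff_const)))
    (fun z hz => by
      have : h z = M := by
        rw [hh]
        simp only [polyFun_normSqPoly]
        rw [norm_smul, Real.norm_of_nonneg (inv_pos.2 hs).le, ← dist_eq_norm, hz,
          inv_mul_cancel₀ hs.ne']
        ring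
      rw [this]
      exact hM z (Metric.mem_closedBall.2 hz.le))
    (y₀ := y) (Metric.mem_closedBall_self hs.le) (by
      rw [ht]
      have : h y = t - 1 := by
        rw [hh]
        simp only [polyFun_normSqPoly, sub_self, smul_zero, norm_zero]
        ring
      rw [this]
      exact_mod_cast (by linarith : t - 1 < t))
  exact ⟨x, hsO (Metric.ball_subset_closedBall hx), _, Metric.ball_subset_closedBall.trans hsO,
    _, hm⟩

variable {ρ : Cn n → ℝ}

theorem IsMollifier.contDiffAt_regularization (hρ : IsMollifier ρ) {O : Set (Cn n)} (hO : IsOpen O)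
    {φ : Cn n → EReal} (hloc : LocallyIntegrableOn (fun z => (φ z).toReal) O volume)
    {δ : ℝ} (hδ : 0 < δ) {z : Cn n} (hz : Metric.closedBall z δ ⊆ O) :
    ContDiffAt ℝ 2 (regularization ρ φ δ) z := by
  obtain ⟨R, hRδ, hRO⟩ := exists_lt_closedBall_subset hO hδ.le hz
  have hint : Integrable ((Metric.closedBall z R).indicator fun t => (φ t).toReal) :=
    (hloc.integrableOn_compact_subset hRO (isCompact_closedBall z R)).integrable_indicator
      measurableSet_closedBall
  refine (hρ.contDiff_convolution hδ hint).contDiffAt.congr_of_eventuallyEq ?_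
  filter_upwards [Metric.ball_mem_nhds z (sub_pos.2 hRδ)] with y hy
  exact hρ.regularization_eqOn hδ (by linarith [Metric.mem_ball.1 hy])

/-- Near the contact point of an upper test `q` there are points where the second derivatives of a
regularization are dominated by those of `q`, up to an arbitrarily small error. Indeed, after `q` is
replaced by a strict test `q + ε|· - x|²`, the maximum of its difference to the regularization is
interior for small `δ`: otherwise the regularizations would stay below the test by a fixed amount,
and so would the function itself, at almost every point and then at `x`. -/
theorem IsMollifier.exists_sumSqDeriv_regularization_le (hρ : IsMollifier ρ) {U : Set (Cn n)}
    {φ : Cn n → EReal} (hφ : IsPsh φ U)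
    (hbot : ∀ᵐ z ∂(volume.restrict U), φ z ≠ ⊥)
    (hloc : LocallyIntegrableOn (fun z => (φ z).toReal) U volume) {x : Cn n} {V : Set (Cn n)}
    {q : Cn n → ℝ} (hq : IsUpperTest φ x V q) (hVU : V ⊆ U) {κ : Type*} [Fintype κ] (v : κ → Cn n)
    {ε r : ℝ} (hε : 0 < ε) (hr : 0 < r) :
    ∃ δ, 0 < δ ∧ ∃ z ∈ Metric.ball x r, Metric.closedBall z δ ⊆ V ∧
      sumSqDeriv v (regularization ρ φ δ) z ≤ sumSqDeriv v q z + ε * (2 * ∑ k, ‖v k‖ ^ 2) := by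
  obtain ⟨s₀, hs₀, hs₀V⟩ := Metric.nhds_basis_closedBall.mem_iff.1 (hq.isOpen.mem_nhds hq.mem)
  set s := min (s₀ / 2) (r / 2) with hs
  have hspos : 0 < s := lt_min (by linarith) (by linarith)
  have hsr : s < r := lt_of_le_of_lt (min_le_right _ _) (by linarith)
  have hKV : Metric.closedBall x (2 * s) ⊆ V :=
    (Metric.closedBall_subset_closedBall (by linarith [min_le_left (s₀ / 2) (r / 2)])).trans hs₀V
  have hKc : IsCompact (Metric.closedBall x (2 * s)) := isCompact_closedBall _ _
  have hVlt : ∀ y ∈ V, φ y < ⊤ := fun y hy => hφ.lt_top y (hVU hy)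
  have hint : IntegrableOn (fun t => (φ t).toReal) (Metric.closedBall x (2 * s)) :=
    hloc.integrableOn_compact_subset (hKV.trans hVU) hKc
  have hKbot : ∀ᵐ t, t ∈ Metric.closedBall x (2 * s) → φ t ≠ ⊥ := by
    have h1 := ae_restrict_of_ae_restrict_of_subset (hKV.trans hVU) hbot
    exact (ae_restrict_iff' measurableSet_closedBall).1 h1
  have hqc : ContinuousOn q (Metric.closedBall x (2 * s)) := hq.smooth.continuousOn.mono hKV
  have huc := Metric.uniformContinuousOn_iff.1 (hKc.uniformContinuousOn_of_continuous hqc)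
  obtain ⟨δ₀, hδ₀, hmod⟩ := huc (ε * s ^ 2 / 4) (by positivity)
  set g : Cn n → ℝ := fun y => q y + ε * polyFun x 1 (normSqPoly n) y with hg
  have hgval : ∀ y, g y = q y + ε * dist y x ^ 2 := fun y => by
    rw [hg]
    simp only [polyFun_normSqPoly, one_smul, dist_eq_norm]
  by_cases hcase : ∃ δ, 0 < δ ∧ δ < δ₀ ∧ δ < s ∧ ∃ y ∈ Metric.closedBall x s,
      g y - ε * s ^ 2 / 2 < regularization ρ φ δ y
  · obtain ⟨δ, hδ, hδδ₀, hδs, y₀, hy₀, hlt₀⟩ := hcase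
    have hballs : ∀ y ∈ Metric.closedBall x s,
        Metric.closedBall y δ ⊆ Metric.closedBall x (2 * s) :=
      fun y hy => Metric.closedBall_subset_closedBall' (by linarith [Metric.mem_closedBall.1 hy])
    have hsm : ∀ y ∈ Metric.closedBall x s, ContDiffAt ℝ 2 (regularization ρ φ δ) y :=
      fun y hy => hρ.contDiffAt_regularization hq.isOpen (hloc.mono_set hVU) hδ
        ((hballs y hy).trans hKV)
    have hgsm : ∀ y ∈ V, ContDiffAt ℝ 2 g y := fun y hy =>
      (hq.smooth.contDiffAt (hq.isOpen.mem_nhds hy)).add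
        (contDiffAt_const.mul (contDiff_polyFun x 1 (normSqPoly n)).contDiffAt)
    have hsV : Metric.closedBall x s ⊆ V :=
      (Metric.closedBall_subset_closedBall (by linarith)).trans hKV
    obtain ⟨z, hz, hmax⟩ := (isCompact_closedBall x s).exists_isMaxOn
      (f := fun y => regularization ρ φ δ y - g y) ⟨y₀, hy₀⟩
      (fun y hy => ((hsm y hy).continuousAt.sub (hgsm y (hsV hy)).continuousAt).continuousWithinAt)
    have hzval : -(ε * s ^ 2 / 2) < regularization ρ φ δ z - g z := by
      have h1 : regularization ρ φ δ y₀ - g y₀ ≤ regularization ρ φ δ z - g z := hmax hy₀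
      linarith
    have hzle : regularization ρ φ δ z ≤ q z + ε * s ^ 2 / 4 := by
      refine hρ.regularization_le_const hδ (hint.mono_set (hballs z hz))
        (hKbot.mono fun t ht h => ht (hballs z hz h)) fun t ht => ?_
      refine (hq.le t (hKV (hballs z hz ht))).trans ?_
      have h1 := hmod t (hballs z hz ht) z (hballs z hz (Metric.mem_closedBall_self hδ.le))
        (lt_of_le_of_lt (Metric.mem_closedBall.1 ht) hδδ₀)
      rw [Real.dist_eq] at h1
      exact_mod_cast (by linarith [(abs_lt.1 h1).2] : q t ≤ q z + ε * s ^ 2 / 4)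
    have hzball : z ∈ Metric.ball x s := by
      refine lt_of_le_of_ne (Metric.mem_closedBall.1 hz) fun heq => ?_
      rw [hgval, heq] at hzval
      have : 0 < ε * s ^ 2 := by positivity
      linarith
    refine ⟨δ, hδ, z, Metric.ball_subset_ball hsr.le hzball, (hballs z hz).trans hKV, ?_⟩
    have hloc' : IsLocalMax (fun y => regularization ρ φ δ y - g y) z :=
      Filter.mem_of_superset (Metric.isOpen_ball.mem_nhds hzball)
        fun y hy => hmax (Metric.ball_subset_closedBall hy)
    have h1 := sumSqDeriv_le_of_isLocalMax_sub v (hsm z hz) (hgsm z (hsV hz)) hloc'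
    have h2 : sumSqDeriv v g z = sumSqDeriv v q z + ε * (2 * ∑ k, ‖v k‖ ^ 2) := by
      have h3 : g = fun y => q y + polyFun x 1 (MvPolynomial.C ε * normSqPoly n) y := by
        funext y; rw [polyFun_mul, polyFun_C]
      rw [h3, sumSqDeriv_add v (hq.smooth.contDiffAt (hq.isOpen.mem_nhds (hsV hz)))
        (contDiff_polyFun _ _ _).contDiffAt, sumSqDeriv_polyFun, ← MvPolynomial.smul_eq_C_mul,
        map_smul, sumSqPoly_normSqPoly, MvPolynomial.smul_eq_C_mul, polyFun_mul, polyFun_C,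
        polyFun_C]
      ring
    linarith
  · exfalso
    push Not at hcase
    have hu : Integrable ((Metric.closedBall x (2 * s)).indicator fun t => (φ t).toReal) :=
      hint.integrable_indicator measurableSet_closedBall
    have hae : ∀ᵐ y, y ∈ Metric.ball x s → φ y ≤ ((g y - ε * s ^ 2 / 2 : ℝ) : EReal) := by
      filter_upwards [hρ.ae_tendsto_convolution hu] with y hy hys
      have hyK : y ∈ Metric.closedBall x (2 * s) :=
        Metric.mem_closedBall.2 (by linarith [Metric.mem_ball.1 hys])
      rw [Set.indicator_of_mem hyK] at hy
      have h1 : (φ y).toReal ≤ g y - ε * s ^ 2 / 2 := by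
        refine le_of_tendsto hy ?_
        have hIoo : Set.Ioo (0 : ℝ) (min δ₀ s) ∈ nhdsWithin (0 : ℝ) (Set.Ioi 0) :=
          Ioo_mem_nhdsGT (lt_min hδ₀ hspos)
        filter_upwards [hIoo] with δ hδ
        have hδs := lt_of_lt_of_le hδ.2 (min_le_right _ _)
        rw [← hρ.regularization_eqOn hδ.1 (by linarith [Metric.mem_ball.1 hys])]
        exact hcase δ hδ.1 (lt_of_lt_of_le hδ.2 (min_le_left _ _)) hδs y
          (Metric.ball_subset_closedBall hys)
      exact (EReal.le_coe_toReal (hVlt y (hKV hyK)).ne).trans (by exact_mod_cast h1)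
    have hgc : ContinuousAt g x :=
      (hq.smooth.continuousOn.continuousAt (hq.isOpen.mem_nhds hq.mem)).add
        (continuousAt_const.mul
          (contDiff_polyFun x 1 (normSqPoly n) (N := 0)).continuous.continuousAt)
    have hgx : g x = q x := by rw [hgval, dist_self]; ring
    have hsq : 0 < ε * s ^ 2 := by positivity
    obtain ⟨s', hs', hs'g⟩ := Metric.eventually_nhds_iff_ball.1
      (hgc.eventually_lt_const (show g x < q x + ε * s ^ 2 / 4 by rw [hgx]; linarith))
    have hx := hφ.le_of_ae_le (x := x) (r := min s s') (K := q x - ε * s ^ 2 / 4)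
      (lt_min hspos hs')
      ((Metric.ball_subset_closedBall.trans (Metric.closedBall_subset_closedBall
        (by linarith [min_le_left s s']))).trans (hKV.trans hVU)) (by
        filter_upwards [hae] with y hy hys
        refine (hy (Metric.ball_subset_ball (min_le_left _ _) hys)).trans ?_
        have h1 := hs'g y (Metric.ball_subset_ball (min_le_right _ _) hys)
        exact_mod_cast (by linarith : g y - ε * s ^ 2 / 2 ≤ q x - ε * s ^ 2 / 4))
    rw [hq.eq] at hx
    have : q x ≤ q x - ε * s ^ 2 / 4 := by exact_mod_cast hx
    linarith

end Touching

/-! ### Continuous families of Hermitian matrices -/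

section HermitianFamilies

open Matrix

/-- A continuous family of Hermitian matrices which is positive definite at one point is positive
semidefinite nearby. -/
theorem eventually_posSemidef_of_posDef {α : Type*} [TopologicalSpace α] {n : ℕ}
    {A : α → Matrix (Fin n) (Fin n) ℂ} {x : α} (hA : ContinuousAt A x)
    (hher : ∀ᶠ z in nhds x, (A z).IsHermitian) (hpos : (A x).PosDef) :
    ∀ᶠ z in nhds x, (A z).PosSemidef := by
  have hmul : Continuous fun p : Matrix (Fin n) (Fin n) ℂ × (Fin n → ℂ) => p.1 *ᵥ p.2 :=
    continuous_fst.matrix_mulVec continuous_snd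
  have hstar : Continuous fun p : Matrix (Fin n) (Fin n) ℂ × (Fin n → ℂ) => star p.2 :=
    continuous_snd.star
  obtain ⟨F, hF, hFval⟩ : ∃ F : Matrix (Fin n) (Fin n) ℂ × (Fin n → ℂ) → ℝ, Continuous F ∧
      ∀ M v, F (M, v) = (star v ⬝ᵥ (M *ᵥ v)).re :=
    ⟨_, Complex.continuous_re.comp (hstar.dotProduct hmul), fun _ _ => rfl⟩
  have key : ∀ᶠ z in nhds x, ∀ v ∈ Metric.sphere (0 : Fin n → ℂ) 1,
      0 < F (A z, v) := by
    refine (isCompact_sphere _ _).eventually_forall_of_forall_eventually fun v hv => ?_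
    have hv0 : v ≠ 0 := by
      rintro rfl
      simp at hv
    have hcont : ContinuousAt (fun p : α × (Fin n → ℂ) => F (A p.1, p.2)) (x, v) := by
      have hA' : ContinuousAt (fun p : α × (Fin n → ℂ) => A p.1) (x, v) :=
        Filter.Tendsto.comp hA continuousAt_fst
      have h1 : ContinuousAt (fun p : α × (Fin n → ℂ) => (A p.1, p.2)) (x, v) :=
        hA'.prodMk continuousAt_snd
      exact (hF.tendsto (A x, v)).comp h1
    refine hcont.eventually_const_lt ?_
    change 0 < F (A x, v)
    rw [hFval]
    exact (Complex.pos_iff.1 (hpos.dotProduct_mulVec_pos hv0)).1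
  filter_upwards [key, hher] with z hz hzher
  refine PosSemidef.of_dotProduct_mulVec_nonneg hzher fun v => ?_
  have him : (star v ⬝ᵥ (A z *ᵥ v)).im = 0 := hzher.im_star_dotProduct_mulVec_self v
  refine Complex.nonneg_iff.2 ⟨?_, him.symm⟩
  rcases eq_or_ne v 0 with rfl | hv
  · simp
  · have h1 := hz ((‖v‖⁻¹ : ℝ) • v) (by
      rw [mem_sphere_zero_iff_norm, norm_smul, norm_inv, norm_norm,
        inv_mul_cancel₀ (norm_ne_zero_iff.2 hv)])
    rw [hFval, star_smul, mulVec_smul, smul_dotProduct, dotProduct_smul, star_trivial, smul_smul,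
      Complex.smul_re, smul_eq_mul] at h1
    exact (pos_of_mul_pos_right h1 (by positivity)).le

end HermitianFamilies

/-! ### Comparison of the two notions of subsolution -/

section Equivalence

variable {n : ℕ} {X : Type*} [TopologicalSpace X] [ChartedSpace (Cn n) X]

theorem IsPsh.mono {φ : Cn n → EReal} {U O : Set (Cn n)} (h : IsPsh φ U) (hO : O ⊆ U) :
    IsPsh φ O :=
  ⟨h.usc.mono hO, fun z hz => h.lt_top z (hO hz), fun z w hw => h.submean z w fun t ht =>
    hO (hw t ht)⟩

theorem complexHessian_eq_zero_of_notMem_tsupport {f : Cn n → ℝ} {z : Cn n}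
    (hz : z ∉ tsupport f) (j k : Fin n) : complexHessian f z j k = 0 := by
  have h0 : f =ᶠ[nhds z] fun _ => 0 := notMem_tsupport_iff_eventuallyEq.1 hz
  have h1 : fderiv ℝ (fderiv ℝ f) z = 0 := by
    rw [h0.fderiv.fderiv_eq, show fderiv ℝ (fun _ : Cn n => (0 : ℝ)) = fun _ => 0 by
      funext y; simp]
    simp
  rw [complexHessian_apply (contDiffAt_const.congr_of_eventuallyEq h0), h1]
  simp

theorem IsLocalPotential.mono {χ : ClosedPositiveCurrent n X} {e : HolChart n X}
    {U O : Set (Cn n)} {φ : Cn n → EReal} (h : IsLocalPotential χ e U φ) (hU : IsOpen U)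
    (hO : O ⊆ U) : IsLocalPotential χ e O φ where
  psh := h.psh.mono hO
  ne_bot := ae_restrict_of_ae_restrict_of_subset hO h.ne_bot
  locInt := h.locInt.mono_set hO
  ddbar j k η hη := by
    rw [← h.ddbar j k η (hη.trans hO)]
    refine (setIntegral_eq_of_subset_of_forall_sdiff_eq_zero hU.measurableSet hO
      fun z hz => ?_).symm
    rw [complexHessian_eq_zero_of_notMem_tsupport fun hz' => hz.2 (hη hz'), mul_zero]

theorem KahlerForm.continuousAt_coeff (ω : KahlerForm n X) (e : HolChart n X) {x : Cn n}
    (hx : x ∈ e.1.target) : ContinuousAt (ω.coeff e) x :=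
  continuousAt_pi.2 fun j => continuousAt_pi.2 fun k =>
    (ω.smooth e j k).continuousOn.continuousAt (e.1.open_target.mem_nhds hx)

end Equivalence

section Main

open Matrix

variable {m : ℕ} {X : Type*} [TopologicalSpace X] [ChartedSpace (Cn (m + 1)) X]
  {ω : KahlerForm (m + 1) X} {c : ℝ} {ρ : Cn (m + 1) → ℝ} {χ : ClosedPositiveCurrent (m + 1) X}

/-- Each linear inequality in the description of `P_{ω₀} ≤ c` follows from the one for the larger
form `ω`, and passes from upper tests to regularizations. -/
theorem IsViscositySubsolution.memGammaBar (hρ : IsMollifier ρ)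
    (h : IsViscositySubsolution ω χ c) : MemGammaBar ρ ω c χ := by
  intro e O hO hOe B hB hBω φ hφ δ hδ z hz
  have hreg := hρ.contDiffAt_regularization hO hφ.locInt hδ hz
  rw [opP_le_iff hB (isHermitian_complexHessian hreg)]
  intro S Y hS
  rw [re_trace_complexHessian hreg]
  rcases eq_or_ne Y 0 with rfl | hY
  -- for `Y = 0` the linear inequality is `0 ≤ c`, which holds because upper tests exist
  · have hzO : z ∈ O := hz (Metric.mem_closedBall_self hδ.le)
    obtain ⟨x, hx, V, hV, q, hq⟩ := exists_isUpperTest hO ⟨z, hzO⟩ hφ.psh.usc hφ.psh.lt_top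
      hφ.ne_bot
    have h1 : (0 : EReal) ≤ c :=
      (EReal.coe_ennreal_nonneg _).trans (h e O hO hOe φ hφ x hx V hV q hq)
    have hc : 0 ≤ c := by exact_mod_cast h1
    rw [← re_trace_complexHessian hreg]
    simpa using hc
  · have h1 := hρ.le_sumSqDeriv_regularization (v := leviDirections Y)
      (b := 2 * (Yᴴ * S).trace.re - c) (exists_leviDirections_ne_zero hY) hO hφ.psh.usc
      hφ.psh.lt_top hφ.ne_bot hφ.locInt (fun x hx V hV q hq => by
        have hqx := hq.smooth.contDiffAt (hq.isOpen.mem_nhds hq.mem)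
        have h2 := (opP_le_iff (ω.posDef e x (hOe hx)) (isHermitian_complexHessian hqx) c).1
          (h e O hO hOe φ hφ x hx V hV q hq) S Y (by
            have := (hBω x hx).add hS
            rwa [sub_add_sub_cancel] at this)
        rw [re_trace_complexHessian hqx] at h2
        linarith) hδ hz
    linarith

/-- On a small ball about `x` the constant form `(1 - ε) ω(x)` lies below `ω`. The linear
inequalities for the regularizations pass to the limit at points which converge to `x` and at which
the second derivatives are dominated by those of the upper test. -/
theorem MemGammaBar.isViscositySubsolution (hρ : IsMollifier ρ) (h : MemGammaBar ρ ω c χ) :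
    IsViscositySubsolution ω χ c := by
  intro e U hU hUe φ hφ x hx V hVU q hq
  have hqx := hq.smooth.contDiffAt (hq.isOpen.mem_nhds hq.mem)
  have hωx := ω.posDef e x (hUe hx)
  rw [opP_le_iff hωx (isHermitian_complexHessian hqx)]
  intro S Y hS
  rw [re_trace_complexHessian hqx]
  set v := leviDirections Y with hv
  have key : ∀ ε ∈ Set.Ioo (0 : ℝ) 1, 2 * (√(1 - ε) * (Yᴴ * S).trace.re)
      ≤ c + (sumSqDeriv v q x + ε + ε * (2 * ∑ k, ‖v k‖ ^ 2)) := by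
    intro ε hε
    have hε' : 0 < 1 - ε := sub_pos.2 hε.2
    have h1 : ∀ᶠ z in nhds x, (ω.coeff e z - (1 - ε) • ω.coeff e x).PosSemidef := by
      refine eventually_posSemidef_of_posDef
        ((ω.continuousAt_coeff e (hUe hx)).sub continuousAt_const) ?_ ?_
      · filter_upwards [e.1.open_target.mem_nhds (hUe hx)] with z hz
        exact (ω.posDef e z hz).isHermitian.sub (hωx.smul hε').isHermitian
      · rw [show ω.coeff e x - (1 - ε) • ω.coeff e x = ε • ω.coeff e x by
          rw [sub_smul, one_smul, sub_sub_cancel]]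
        exact hωx.smul hε.1
    have h2 : ∀ᶠ z in nhds x, sumSqDeriv v q z < sumSqDeriv v q x + ε :=
      ((hq.smooth.continuousOn_sumSqDeriv v hq.isOpen).continuousAt
        (hq.isOpen.mem_nhds hq.mem)).eventually_lt_const (by linarith [hε.1])
    obtain ⟨r, hr, hrO⟩ := Metric.eventually_nhds_iff_ball.1
      (h1.and (h2.and (hq.isOpen.mem_nhds hq.mem)))
    have hOV : Metric.ball x r ⊆ V := fun z hz => (hrO z hz).2.2
    have hOU := hOV.trans hVU
    have hq' : IsUpperTest φ x (Metric.ball x r) q :=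
      ⟨Metric.isOpen_ball, Metric.mem_ball_self hr, hq.smooth.mono hOV,
        fun y hy => hq.le y (hOV hy), hq.eq⟩
    obtain ⟨δ, hδ, z, hz, hzδ, hle⟩ := hρ.exists_sumSqDeriv_regularization_le hφ.psh hφ.ne_bot
      hφ.locInt hq' hOU v hε.1 hr
    have hreg := hρ.contDiffAt_regularization hU hφ.locInt hδ (hzδ.trans hOU)
    have h3 := (opP_le_iff (hωx.smul hε') (isHermitian_complexHessian hreg) c).1
      (h e (Metric.ball x r) Metric.isOpen_ball (hOU.trans hUe) _ (hωx.smul hε')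
        (fun y hy => (hrO y hy).1) φ (hφ.mono hU hOU) δ hδ z hzδ) (√(1 - ε) • S) Y (by
        have h4 : (1 - ε) • ω.coeff e x - (√(1 - ε) • S) * (√(1 - ε) • S)ᴴ
            = (1 - ε) • (ω.coeff e x - S * Sᴴ) := by
          rw [conjTranspose_smul, star_trivial, Matrix.smul_mul, Matrix.mul_smul, smul_smul,
            Real.mul_self_sqrt hε'.le, smul_sub]
        rw [h4]
        exact hS.smul hε'.le)
    rw [re_trace_complexHessian hreg, Matrix.mul_smul, trace_smul, Complex.smul_re, smul_eq_mul]
      at h3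
    linarith [(hrO z hz).2.1]
  have hlim1 : Filter.Tendsto (fun ε : ℝ => 2 * (√(1 - ε) * (Yᴴ * S).trace.re))
      (nhdsWithin 0 (Set.Ioi 0)) (nhds (2 * (Yᴴ * S).trace.re)) := by
    have : Continuous fun ε : ℝ => 2 * (√(1 - ε) * (Yᴴ * S).trace.re) := by fun_prop
    simpa using this.continuousAt.tendsto.mono_left (nhdsWithin_le_nhds (a := (0 : ℝ)))
  have hlim2 : Filter.Tendsto
      (fun ε : ℝ => c + (sumSqDeriv v q x + ε + ε * (2 * ∑ k, ‖v k‖ ^ 2)))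
      (nhdsWithin 0 (Set.Ioi 0)) (nhds (c + sumSqDeriv v q x)) := by
    have : Continuous fun ε : ℝ => c + (sumSqDeriv v q x + ε + ε * (2 * ∑ k, ‖v k‖ ^ 2)) := by
      fun_prop
    simpa using this.continuousAt.tendsto.mono_left (nhdsWithin_le_nhds (a := (0 : ℝ)))
  exact le_of_tendsto_of_tendsto hlim1 hlim2
    (Filter.mem_of_superset (Ioo_mem_nhdsGT zero_lt_one) key)

end Main

theorem mainTheorem7 (n : ℕ) (hn : 1 ≤ n) (X : Type*) [TopologicalSpace X] [T2Space X]
    [SecondCountableTopology X] [ChartedSpace (Cn n) X]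
    [IsManifold 𝓘(ℂ, Cn n) (⊤ : WithTop ℕ∞) X]
    (ω : KahlerForm n X) (c : ℝ) (ρ : Cn n → ℝ) (hρ : IsMollifier ρ)
    (χ : ClosedPositiveCurrent n X) :
    IsViscositySubsolution ω χ c ↔ MemGammaBar ρ ω c χ := by
  obtain ⟨m, rfl⟩ : ∃ m, n = m + 1 := ⟨n - 1, by omega⟩
  exact ⟨fun h => h.memGammaBar hρ, fun h => h.isViscositySubsolution hρ⟩
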